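/- There are absolute constants $c, C > 0$ such that the following holds for every prime $p$, every subgroup $\mathcal G$ of $\mathbb F_p^*$ and all $\lambda, \mu \in \mathbb F_p^*$. Put $$ \mathcal S_1 = \mathcal G + \lambda \mathcal G + \mu \mathcal G = \{u + \lambda v + \mu w : u,v,w \in \mathcal G\}, \qquad \mathcal S_2 = \left\{ \frac{u-\lambda}{v-\mu} : u, v \in \mathcal G,\ v \ne \mu \right\}, $$ and $\mathcal G \mathcal S_2 = \{ g s : g \in \mathcal G,\ s \in \mathcal S_2\}$. 1. If $|\mathcal G| \ge p^{2/3}$, then $\mathbb F_p^* \subseteq \mathcal S_1$ and $\mathbb F_p^* \subseteq \mathcal G \mathcal S_2$. 2. If $2 \le |\mathcal G| \le (p \log p)^{1/2}$, then $|\mathcal S_i| \ge c\, |\mathcal G|^2/\log |\mathcal G|$ for $i = 1, 2$. 3. For $i = 1, 2$, $$ p - |\mathcal S_i| \le C \cdot \begin{cases} p^{5/2} |\mathcal G|^{-5/2}, & \text{if } |\mathcal G| \ge p^{2/3},\\ p^{3/2} |\mathcal G|^{-1}, & \text{if } p^{2/3} > |\mathcal G| \ge p^{1/2} \log p,\\ p^{2}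 |\mathcal G|^{-2} \log p, & \text{if } p^{1/2} \log p \ge |\mathcal G| > (p \log p)^{1/2}. \end{cases} $$ (The three bounds are asserted independently, each under its own condition.) -/

import Mathlib

open scoped Pointwise

/-- A multiplicative subgroup of `F_p^*`, viewed as a subset of the field `F_p`. -/
def subgroupSet {p : ℕ} (G : Subgroup (ZMod p)ˣ) : Set (ZMod p) :=
  {x | ∃ g ∈ G, (g : ZMod p) = x}

/-- `S₁ = G + l G + m G`, with sums of sets and dilates taken elementwise. -/
def tripleSumset {p : ℕ} (G : Subgroup (ZMod p)ˣ) (l m : ZMod p) : Set (ZMod p) :=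
  subgroupSet G + l • subgroupSet G + m • subgroupSet G

/-- `S₂ = {(u - l) / (v - m) : u, v ∈ G}`, where, as usual for values of a rational function,
the poles (that is, the pairs with `v = m`) are left out. -/
def shiftedRatioSet {p : ℕ} [Fact p.Prime] (G : Subgroup (ZMod p)ˣ) (l m : ZMod p) :
    Set (ZMod p) :=
  {x | ∃ u ∈ subgroupSet G, ∃ v ∈ subgroupSet G, v ≠ m ∧ x = (u - l) / (v - m)}

/-!
Write `n` for the order of `G`.

Both sets are governed by the multiplicative energy of the shifts `G - l` and `G - m`. The ratio set
consists of the ratios `(u - l) / (v - m)`. The triple sumset contains a translate of the set of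
products of two shifts, because `a b + l a + m b = (a + m) (b + l) - l m`. Products and ratios have
representation functions with the same first and second moments (`sum_sq_prodCount`). So an upper
bound for the energy gives many values (`IsShiftCount.le_supportCard`), and an upper bound for the
variance gives few missing values (`IsShiftCount.sub_supportCard_le`).

The number of representations of a ratio `t` is the number of points of `G × G` on the line of slope
`t` through `(l, m)`. Averaging over the translates of this point by `G × G` replaces sums over these
lines by sums over all lines `a x + b y = 1`, weighted by the number of translates that they contain
(`sum_slopeCount_eq`). The second moment over all lines is elementary (`sum_sq_lineCount_sub_le`).
If `n ≥ p ^ (2 / 3)`, bounding the weights through exponential sums suffices (`variance_le_of_sqrt`). If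
`n ≤ p ^ (2 / 3)`, the lines with many points are controlled by their third moment
(`variance_le_of_stepanov`, `sum_sq_ratioCount_le`).

The third moment comes from Stepanov's method. The points of a line correspond to the solutions of
`X ^ n = a ^ n`, `(1 - X) ^ n = b ^ n`. A nonzero polynomial of controlled degree that vanishes to
high order on the solution sets of many such systems (`stepanov_bound`) shows that at most
`O(n ^ 2 / τ ^ 3)` systems have `τ` or more solutions (`card_richPairs_mul_le`). Summing over dyadic
`τ` costs one logarithm.

That everything nonzero is represented when `n ≥ p ^ (2 / 3)` follows by counting the solutions in
`G` of a homogeneous linear equation in four variables, with the bound `(p - n) ^ (1 / 2)` for the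
nontrivial exponential sums over `G` (`le_card_quadSolutions`). For the ratio set, at most `n ^ 2`
solutions have a vanishing denominator, and there are more than `n ^ 2` solutions.
-/

/-! ### Sparse polynomials and a derivation -/

open Polynomial in
/-- A sparse polynomial of degree below `p` with at most `N` terms does not vanish to order `N` at
`1`, unless it is zero: `X d/dX - e` removes the term of degree `e` and lowers the order of
vanishing by at most one. The bound on the degree keeps distinct exponents distinct modulo `p`. -/
theorem eq_zero_of_one_sub_X_pow_dvd {p : ℕ} [Fact p.Prime] (N : ℕ) :
    ∀ F : (ZMod p)[X], F.support.card ≤ N → (∀ j ∈ F.support, j < p) →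
      (1 - X) ^ N ∣ F → F = 0 := by
  induction N with
  | zero =>
    intro F hF _ _
    simpa using hF
  | succ N ih =>
    intro F hcard hlt hdvd
    by_contra hF
    obtain ⟨e, he⟩ : F.support.Nonempty := by simpa [Finset.nonempty_iff_ne_empty] using hF
    have hcoeff : ∀ j : ℕ, (X * derivative F - C (e : ZMod p) * F).coeff j
        = ((j : ZMod p) - e) * F.coeff j := by
      intro j
      rcases j with _ | j
      · simp
      · simp [coeff_X_mul, coeff_derivative]; ring
    have hzero : X * derivative F - C (e : ZMod p) * F = 0 := by
      apply ih
      · have hsub : (X * derivative F - C (e : ZMod p) * F).support ⊆ F.support.erase e := by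
          intro j hj
          rw [mem_support_iff, hcoeff] at hj
          rw [Finset.mem_erase, mem_support_iff]
          refine ⟨?_, right_ne_zero_of_mul hj⟩
          rintro rfl
          simp at hj
        have := Finset.card_le_card hsub
        rw [Finset.card_erase_of_mem he] at this
        omega
      · intro j hj
        rw [mem_support_iff, hcoeff] at hj
        exact hlt j (mem_support_iff.2 (right_ne_zero_of_mul hj))
      · obtain ⟨Q, rfl⟩ := hdvd
        refine ⟨X * (-(N + 1 : (ZMod p)[X]) * Q + (1 - X) * derivative Q)
          - C (e : ZMod p) * (1 - X) * Q, ?_⟩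
        simp only [derivative_mul, derivative_pow, derivative_sub, derivative_one, derivative_X,
          Nat.add_sub_cancel]
        push_cast
        simp only [map_add, map_natCast, map_one]
        ring
    have hmono : F = C (F.coeff e) * X ^ e := by
      ext j
      rw [coeff_C_mul_X_pow]
      split_ifs with hje
      · rw [hje]
      · by_contra hj
        have h1 := hcoeff j
        rw [hzero, coeff_zero, eq_comm, mul_eq_zero, or_iff_left hj, sub_eq_zero,
          ZMod.natCast_eq_natCast_iff', Nat.mod_eq_of_lt (hlt j (mem_support_iff.2 hj)),
          Nat.mod_eq_of_lt (hlt e he)] at h1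
        exact hje h1
    obtain ⟨Q, hQ⟩ := hdvd
    have h2 : F.eval 1 = 0 := by rw [hQ]; simp
    rw [hmono] at h2
    simp at h2
    exact (mem_support_iff.1 he) h2

open Polynomial in
/-- If no nonzero `F c` is divisible by `W`, then `∑ F c * W ^ c = 0` only for `F = 0`: otherwise the
lowest nonzero coefficient would be divisible by `W`. -/
theorem eq_zero_of_sum_mul_pow_eq_zero {K : Type*} [Field K] {W : K[X]} (hW : W ≠ 0) (B : ℕ) :
    ∀ F : ℕ → K[X], (∀ c, W ∣ F c → F c = 0) →
      ∑ c ∈ Finset.range B, F c * W ^ c = 0 → ∀ c < B, F c = 0 := by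
  induction B with
  | zero => intro F _ _ c hc; omega
  | succ B ih =>
    intro F hF hsum
    rw [Finset.sum_range_succ'] at hsum
    have h1 : ∑ c ∈ Finset.range B, F (c + 1) * W ^ (c + 1)
        = W * ∑ c ∈ Finset.range B, F (c + 1) * W ^ c := by
      rw [Finset.mul_sum]
      exact Finset.sum_congr rfl fun c _ => by ring
    have h0 : F 0 = 0 := by
      apply hF
      rw [h1] at hsum
      refine ⟨-∑ c ∈ Finset.range B, F (c + 1) * W ^ c, ?_⟩
      linear_combination hsum
    rw [h0, h1, zero_mul, add_zero, mul_eq_zero, or_iff_right hW] at hsum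
    have := ih (fun c => F (c + 1)) (fun c => hF (c + 1)) hsum
    intro c hc
    rcases c with _ | c
    · exact h0
    · exact this c (by omega)

open Polynomial in
/-- The derivation `X (1 - X) d/dX`. -/
noncomputable def thetaDeriv {K : Type*} [Field K] (Q : K[X]) : K[X] :=
  X * (1 - X) * derivative Q

open Polynomial in
/-- The operator on the cofactor `Q` induced by `thetaDeriv` on `Q X ^ r (1 - X) ^ s`. -/
noncomputable def twistedTheta {K : Type*} [Field K] (r s : ℕ) (Q : K[X]) : K[X] :=
  X * (1 - X) * derivative Q + (r : K[X]) * (1 - X) * Q - (s : K[X]) * X * Q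

open Polynomial in
theorem thetaDeriv_mul_pow {K : Type*} [Field K] (r s : ℕ) (Q : K[X]) :
    thetaDeriv (Q * (X ^ r * (1 - X) ^ s)) = twistedTheta r s Q * (X ^ r * (1 - X) ^ s) := by
  unfold thetaDeriv twistedTheta
  rcases r with _ | r <;> rcases s with _ | s <;>
  · simp only [derivative_mul, derivative_pow, derivative_sub, derivative_one, derivative_X,
      Nat.add_sub_cancel]
    push_cast
    simp only [map_add, map_natCast, map_one, map_zero]
    ring

open Polynomial in
theorem thetaDeriv_iterate_mul_pow {K : Type*} [Field K] (r s d : ℕ) (Q : K[X]) :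
    thetaDeriv^[d] (Q * (X ^ r * (1 - X) ^ s))
      = (twistedTheta r s)^[d] Q * (X ^ r * (1 - X) ^ s) := by
  induction d with
  | zero => rfl
  | succ d ih => rw [Function.iterate_succ_apply', ih, thetaDeriv_mul_pow,
      Function.iterate_succ_apply']

open Polynomial in
theorem thetaDeriv_iterate_sum {K ι : Type*} [Field K] (s : Finset ι) (f : ι → K[X]) (c : ι → K)
    (d : ℕ) : thetaDeriv^[d] (∑ i ∈ s, C (c i) * f i) = ∑ i ∈ s, C (c i) * thetaDeriv^[d] (f i) := by
  induction d with
  | zero => rfl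
  | succ d ih =>
    simp only [Function.iterate_succ_apply', ih]
    simp only [thetaDeriv, derivative_sum, Finset.mul_sum, derivative_mul, derivative_C]
    exact Finset.sum_congr rfl fun i _ => by ring

open Polynomial in
theorem natDegree_twistedTheta_iterate_le {K : Type*} [Field K] (r s a d : ℕ) :
    ((twistedTheta r s)^[d] (X ^ a : K[X])).natDegree ≤ a + d := by
  induction d with
  | zero => simp
  | succ d ih =>
    rw [Function.iterate_succ_apply']
    set Q := (twistedTheta r s)^[d] (X ^ a : K[X])
    rw [show twistedTheta r s Q = X * (1 - X) * derivative Q + C (r : K) * (1 - X) * Q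
      - C (s : K) * X * Q by simp [twistedTheta]]
    have hX : (1 - X : K[X]).natDegree ≤ 1 := by compute_degree
    refine (natDegree_sub_le _ _).trans
      (max_le ((natDegree_add_le _ _).trans (max_le ?_ ?_)) ?_)
    · rcases Nat.eq_zero_or_pos Q.natDegree with h0 | h0
      · rw [natDegree_eq_zero] at h0
        obtain ⟨c, hc⟩ := h0
        simp [← hc]
      · have h1 := natDegree_derivative_le Q
        have h2 : (X * (1 - X) : K[X]).natDegree ≤ 2 := by compute_degree
        have h3 := natDegree_mul_le_of_le h2 h1
        omega
    · have h2 : (C (r : K) * (1 - X) : K[X]).natDegree ≤ 1 := by compute_degree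
      have h3 := natDegree_mul_le_of_le h2 ih
      omega
    · have h2 : (C (s : K) * X : K[X]).natDegree ≤ 1 := by compute_degree
      have h3 := natDegree_mul_le_of_le h2 ih
      omega

open Polynomial in
/-- Away from `0` and `1`, iterates of `thetaDeriv` detect the order of vanishing up to order `p`. -/
theorem sub_C_pow_dvd_of_thetaDeriv {p : ℕ} [Fact p.Prime] {x : ZMod p} (hx0 : x ≠ 0)
    (hx1 : x ≠ 1) (D : ℕ) (hD : D ≤ p) (Q : (ZMod p)[X])
    (hQ : ∀ d < D, (thetaDeriv^[d] Q).eval x = 0) : (X - C x) ^ D ∣ Q := by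
  -- `thetaDeriv` lowers the order of vanishing at `x` by exactly one, as long as it is below `p`.
  have key : ∀ e, e < p → ∀ R : (ZMod p)[X], R.eval x ≠ 0 →
      (thetaDeriv^[e] ((X - C x) ^ e * R)).eval x ≠ 0 := by
    intro e
    induction e with
    | zero => intro _ R hR; simpa using hR
    | succ e ih =>
      intro he R hR
      rw [Function.iterate_succ_apply]
      have h1 : thetaDeriv ((X - C x) ^ (e + 1) * R) = (X - C x) ^ e *
          (X * (1 - X) * ((e + 1 : ℕ) : (ZMod p)[X]) * R + (X - C x) * thetaDeriv R) := by
        unfold thetaDeriv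
        simp only [derivative_mul, derivative_pow, derivative_sub, derivative_X, derivative_C,
          Nat.add_sub_cancel]
        push_cast
        simp only [map_add, map_natCast, map_one]
        ring
      rw [h1]
      apply ih (by omega)
      simp only [eval_add, eval_mul, eval_X, eval_sub, eval_one, eval_C, eval_natCast, sub_self,
        zero_mul, add_zero]
      have h2 : ((e + 1 : ℕ) : ZMod p) ≠ 0 := by
        rw [Ne, ZMod.natCast_eq_zero_iff]
        exact Nat.not_dvd_of_pos_of_lt (by omega) he
      exact mul_ne_zero (mul_ne_zero (mul_ne_zero hx0 (sub_ne_zero.2 hx1.symm)) h2) hR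
  by_cases hQ0 : Q = 0
  · simp [hQ0]
  obtain ⟨R, hR, hdvd⟩ := exists_eq_pow_rootMultiplicity_mul_and_not_dvd Q hQ0 x
  by_contra hcon
  have hlt : Q.rootMultiplicity x < D := by
    by_contra hge
    push Not at hge
    exact hcon ((pow_dvd_pow _ hge).trans (pow_rootMultiplicity_dvd Q x))
  have := key _ (hlt.trans_le hD) R (by rwa [dvd_iff_isRoot] at hdvd)
  rw [← hR] at this
  exact this (hQ _ hlt)

/-! ### Stepanov's method -/

/-- The solutions of `X ^ n = a`, `(1 - X) ^ n = b`. -/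
def powFiber {p : ℕ} [Fact p.Prime] (n : ℕ) (a b : ZMod p) : Finset (ZMod p) :=
  Finset.univ.filter fun x => x ^ n = a ∧ (1 - x) ^ n = b

theorem exists_ne_zero_mulVec_eq_zero {K ι κ : Type*} [Field K] [Fintype ι] [Fintype κ]
    (M : κ → ι → K) (h : Fintype.card κ < Fintype.card ι) :
    ∃ c : ι → K, c ≠ 0 ∧ ∀ k, ∑ i, c i * M k i = 0 := by
  classical
  have h1 : LinearMap.ker (Matrix.toLin' (Matrix.of M)) ≠ ⊥ := by
    apply LinearMap.ker_ne_bot_of_finrank_lt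
    simpa using h
  obtain ⟨c, hc, hc0⟩ := (Submodule.ne_bot_iff _).1 h1
  refine ⟨c, hc0, fun k => ?_⟩
  have := congrFun (LinearMap.mem_ker.1 hc) k
  simp only [Matrix.toLin'_apply, Matrix.mulVec, dotProduct, Matrix.of_apply, Pi.zero_apply] at this
  rw [← this]
  exact Finset.sum_congr rfl fun i _ => mul_comm _ _

open Polynomial in
/-- The auxiliary polynomial of Stepanov's method is nonzero as soon as one of its coefficients is.
The condition `A * B ≤ n` makes the polynomials in front of the powers of `(1 - X) ^ n` sparse, and
`A + n * B ≤ p` keeps their degrees below `p`. -/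
theorem linearIndependent_stepanov {p : ℕ} [Fact p.Prime] {n A B : ℕ} (hB : 1 ≤ B)
    (hAB : A * B ≤ n) (hp : A + n * B ≤ p) (c : Fin A × Fin B × Fin B → ZMod p)
    (hc : ∑ i, C (c i) * (X ^ (i.1 : ℕ) * (X ^ (n * i.2.1) * (1 - X) ^ (n * i.2.2))) = 0) :
    c = 0 := by
  have hAn : A ≤ n := le_trans (Nat.le_mul_of_pos_right A hB) hAB
  set F : ℕ → (ZMod p)[X] := fun w => if hw : w < B then
    ∑ i : Fin A × Fin B, C (c (i.1, i.2, ⟨w, hw⟩)) * X ^ ((i.1 : ℕ) + n * i.2) else 0 with hF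
  have hsum : ∑ w ∈ Finset.range B, F w * ((1 - X) ^ n) ^ w = 0 := by
    rw [← hc, Finset.sum_range, Fintype.sum_prod_type, Fintype.sum_congr _ _
      (fun a => Fintype.sum_prod_type _), Fintype.sum_congr _ _ (fun a => Finset.sum_comm),
      Finset.sum_comm]
    refine Finset.sum_congr rfl fun w _ => ?_
    simp only [hF, w.2, dif_pos, Finset.sum_mul, Fintype.sum_prod_type]
    refine Finset.sum_congr rfl fun a _ => Finset.sum_congr rfl fun b _ => ?_
    rw [pow_add, pow_mul (1 - X)]
    ring
  -- distinct pairs of indices give distinct exponents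
  have hinj : ∀ i j : Fin A × Fin B, (i.1 : ℕ) + n * i.2 = (j.1 : ℕ) + n * j.2 → i = j := by
    intro i j hij
    have h1 := congrArg (· % n) hij
    have h2 := congrArg (· / n) hij
    have hn : 0 < n := by omega
    have hi := i.1.2
    have hj := j.1.2
    simp only [Nat.add_mul_mod_self_left, Nat.add_mul_div_left _ _ hn] at h1 h2
    rw [Nat.mod_eq_of_lt (by omega), Nat.mod_eq_of_lt (by omega)] at h1
    rw [Nat.div_eq_of_lt (by omega), Nat.div_eq_of_lt (by omega)] at h2
    exact Prod.ext (Fin.ext h1) (Fin.ext (by omega))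
  have hcoeff : ∀ w : Fin B, ∀ i : Fin A × Fin B,
      (F w).coeff ((i.1 : ℕ) + n * i.2) = c (i.1, i.2, w) := by
    intro w i
    simp only [hF, w.2, dif_pos, finsetSum_coeff, coeff_C_mul_X_pow]
    rw [Finset.sum_eq_single i]
    · simp
    · intro j _ hji
      rw [if_neg fun h => hji (hinj _ _ h).symm]
    · simp
  have hsupp : ∀ w, (F w).support ⊆
      Finset.univ.image fun i : Fin A × Fin B => (i.1 : ℕ) + n * i.2 := by
    intro w e he
    rw [mem_support_iff] at he
    by_cases hw : w < B
    · simp only [hF, hw, dif_pos, finsetSum_coeff, coeff_C_mul_X_pow] at he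
      obtain ⟨i, -, hi⟩ := Finset.exists_ne_zero_of_sum_ne_zero he
      rw [Finset.mem_image]
      refine ⟨i, Finset.mem_univ _, ?_⟩
      by_contra hne
      exact hi (if_neg fun h => hne h.symm)
    · simp [hF, hw] at he
  have hW : ((1 - X : (ZMod p)[X]) ^ n) ≠ 0 := by
    apply pow_ne_zero
    intro h
    have := congrArg (eval 0) h
    simp at this
  have hzero := eq_zero_of_sum_mul_pow_eq_zero hW B F ?_ hsum
  · funext ⟨a, b, w⟩
    rw [← hcoeff w (a, b), hzero w w.2]
    simp
  · intro w hdvd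
    refine eq_zero_of_one_sub_X_pow_dvd n (F w) ?_ ?_ hdvd
    · refine (Finset.card_le_card (hsupp w)).trans (Finset.card_image_le.trans ?_)
      simpa using hAB
    · intro j hj
      obtain ⟨i, -, rfl⟩ := Finset.mem_image.1 (hsupp w hj)
      have h1 := i.1.2
      have h2 : n * (i.2 : ℕ) ≤ n * B := Nat.mul_le_mul_left _ i.2.2.le
      omega

open Polynomial in
theorem card_mul_le_natDegree {K : Type*} [Field K] {Q : K[X]} (hQ : Q ≠ 0) (D : ℕ)
    (s : Finset K) (h : ∀ x ∈ s, (X - C x) ^ D ∣ Q) : D * s.card ≤ Q.natDegree := by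
  have h1 : ∏ x ∈ s, (X - C x) ^ D ∣ Q := by
    refine Finset.prod_dvd_of_coprime (fun x _ y _ hxy => ?_) h
    exact (pairwise_coprime_X_sub_C (fun _ _ h => h) hxy).pow
  have h2 := natDegree_le_of_dvd h1 hQ
  rw [Finset.prod_pow, natDegree_pow, natDegree_prod _ _ fun x _ => X_sub_C_ne_zero x] at h2
  simpa using h2

open Polynomial in
/-- Stepanov's method: if `2 |T| A < B ^ 2`, some nonzero combination of the polynomials
`X ^ a (X ^ n) ^ b ((1 - X) ^ n) ^ c` with `a < A` and `b, c < B` vanishes to order `A` on all the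
fibres over `T`, and its degree bounds the number of points of these fibres. -/
theorem stepanov_bound {p : ℕ} [Fact p.Prime] {n A B : ℕ} (hA : 1 ≤ A)
    (hAB : A * B ≤ n) (hp : A + n * B ≤ p) (T : Finset (ZMod p × ZMod p))
    (hT : ∀ q ∈ T, q.1 ≠ 0 ∧ q.2 ≠ 0) (hcard : 2 * T.card * A < B ^ 2) :
    A * ∑ q ∈ T, (powFiber n q.1 q.2).card ≤ A + 2 * (n * B) := by
  have hB : 1 ≤ B := by
    rcases B with _ | B
    · simp at hcard
    · omega
  have hn : 1 ≤ n := le_trans (Nat.mul_le_mul hA hB) hAB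
  obtain ⟨c, hc0, hc⟩ := exists_ne_zero_mulVec_eq_zero (K := ZMod p)
    (ι := Fin A × Fin B × Fin B) (κ := T × Fin A × Fin (2 * A))
    (fun k i => k.1.1.1 ^ (i.2.1 : ℕ) * k.1.1.2 ^ (i.2.2 : ℕ) *
      ((twistedTheta (n * i.2.1) (n * i.2.2))^[k.2.1] (X ^ (i.1 : ℕ) : (ZMod p)[X])).coeff k.2.2)
    -- `2 |T| A ^ 2` linear conditions on `A B ^ 2` coefficients
    (by
      simp only [Fintype.card_prod, Fintype.card_coe, Fintype.card_fin]
      nlinarith)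
  set Q : (ZMod p)[X] :=
    ∑ i, C (c i) * (X ^ (i.1 : ℕ) * (X ^ (n * i.2.1) * (1 - X) ^ (n * i.2.2))) with hQ
  have hQ0 : Q ≠ 0 := fun h => hc0 (linearIndependent_stepanov hB hAB hp c h)
  have hdeg : Q.natDegree ≤ A + 2 * (n * B) := by
    refine natDegree_sum_le_of_forall_le _ _ fun i _ => ?_
    have h1 := i.1.2
    have h2 : n * (i.2.1 : ℕ) ≤ n * B := Nat.mul_le_mul_left _ i.2.1.2.le
    have h3 : n * (i.2.2 : ℕ) ≤ n * B := Nat.mul_le_mul_left _ i.2.2.2.le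
    have h4 : (1 - X : (ZMod p)[X]).natDegree ≤ 1 := by compute_degree
    have h5 : ((1 - X : (ZMod p)[X]) ^ (n * (i.2.2 : ℕ))).natDegree ≤ n * i.2.2 := by
      refine natDegree_pow_le.trans ?_
      simpa using Nat.mul_le_mul_left (n * (i.2.2 : ℕ)) h4
    refine (natDegree_C_mul_le _ _).trans ?_
    have h6 := natDegree_mul_le_of_le (natDegree_X_pow_le (R := ZMod p) (n * (i.2.1 : ℕ))) h5
    have h7 := natDegree_mul_le_of_le (natDegree_X_pow_le (R := ZMod p) (i.1 : ℕ)) h6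
    omega
  have hdvd : ∀ q ∈ T, ∀ x ∈ powFiber n q.1 q.2, (X - C x) ^ A ∣ Q := by
    intro q hq x hx
    simp only [powFiber, Finset.mem_filter, Finset.mem_univ, true_and] at hx
    have hx0 : x ≠ 0 := by
      rintro rfl
      exact (hT q hq).1 (by rw [← hx.1, zero_pow (by omega)])
    have hx1 : x ≠ 1 := by
      rintro rfl
      exact (hT q hq).2 (by rw [← hx.2, sub_self, zero_pow (by omega)])
    refine sub_C_pow_dvd_of_thetaDeriv hx0 hx1 A (by omega) Q fun d hd => ?_
    rw [hQ, thetaDeriv_iterate_sum]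
    simp only [thetaDeriv_iterate_mul_pow]
    -- On the fibre of `q` the factors `X ^ (n b) (1 - X) ^ (n c)` are constants, which leaves a
    -- polynomial of degree below `2 A` whose coefficients vanish.
    have hR : ∑ i, C (c i * (q.1 ^ (i.2.1 : ℕ) * q.2 ^ (i.2.2 : ℕ))) *
        (twistedTheta (n * i.2.1) (n * i.2.2))^[d] (X ^ (i.1 : ℕ) : (ZMod p)[X]) = 0 := by
      ext j
      rw [finsetSum_coeff, coeff_zero]
      by_cases hj : j < 2 * A
      · rw [← hc (⟨q, hq⟩, ⟨d, hd⟩, ⟨j, hj⟩)]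
        exact Finset.sum_congr rfl fun i _ => by rw [coeff_C_mul]; ring
      · refine Finset.sum_eq_zero fun i _ => ?_
        rw [coeff_C_mul, coeff_eq_zero_of_natDegree_lt, mul_zero]
        have := natDegree_twistedTheta_iterate_le (K := ZMod p) (n * i.2.1) (n * i.2.2) i.1 d
        have h1 := i.1.2
        omega
    have hev := congrArg (eval x) hR
    rw [eval_zero, eval_finsetSum] at hev
    rw [eval_finsetSum, ← hev]
    refine Finset.sum_congr rfl fun i _ => ?_
    simp only [eval_mul, eval_C, eval_pow, eval_X, eval_sub, eval_one]
    rw [pow_mul x, pow_mul (1 - x), hx.1, hx.2]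
    ring
  have hunion : (T.biUnion fun q => powFiber n q.1 q.2).card
      = ∑ q ∈ T, (powFiber n q.1 q.2).card := by
    refine Finset.card_biUnion fun q _ r _ hqr => ?_
    rw [Function.onFun, Finset.disjoint_left]
    intro x hx hx'
    simp only [powFiber, Finset.mem_filter, Finset.mem_univ, true_and] at hx hx'
    exact hqr (Prod.ext (hx.1.symm.trans hx'.1) (hx.2.symm.trans hx'.2))
  rw [← hunion]
  refine (card_mul_le_natDegree hQ0 A _ fun x hx => ?_).trans hdeg
  obtain ⟨q, hq, hx⟩ := Finset.mem_biUnion.1 hx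
  exact hdvd q hq x hx

/-! ### Rich fibres -/

theorem card_powFiber_le {p : ℕ} [Fact p.Prime] {n : ℕ} (hn : 0 < n) (a b : ZMod p) :
    (powFiber n a b).card ≤ n := by
  have h : powFiber n a b ⊆ (Polynomial.nthRoots n a).toFinset := by
    intro x hx
    simp only [powFiber, Finset.mem_filter, Finset.mem_univ, true_and] at hx
    rw [Multiset.mem_toFinset, Polynomial.mem_nthRoots hn]
    exact hx.1
  exact (Finset.card_le_card h).trans
    ((Multiset.toFinset_card_le _).trans (Polynomial.card_nthRoots n a))

/-- The pairs `(a, b)` of nonzero elements whose fibre has at least `τ` points. -/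
def richPairs {p : ℕ} [Fact p.Prime] (n τ : ℕ) : Finset (ZMod p × ZMod p) :=
  Finset.univ.filter fun q => (q.1 ≠ 0 ∧ q.2 ≠ 0) ∧ τ ≤ (powFiber n q.1 q.2).card

/-- The number of fibres with at least `τ` points is `O(n ^ 2 / τ ^ 3)`, in the range where `τ`
exceeds a large multiple of `n ^ 2 / p`. `stepanov_bound` is applied with `A` of order `τ` and `B` of
order `n / A`. -/
theorem card_richPairs_mul_le {p : ℕ} [Fact p.Prime] {n τ : ℕ} (hn0 : 0 < n)
    (hnp : n ^ 3 ≤ p ^ 2) (hτ : 2 ^ 31 ≤ τ) (hτp : 2 ^ 31 * n ^ 2 ≤ τ * p) :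
    (richPairs (p := p) n τ).card * τ ^ 3 ≤ 2 ^ 27 * n ^ 2 := by
  set k := (richPairs (p := p) n τ).card with hk
  rcases Nat.eq_zero_or_pos k with hk0 | hkpos
  · simp [hk0]
  have hp1 : 1 ≤ p := (Fact.out : p.Prime).one_le
  obtain ⟨q, hq⟩ := Finset.card_pos.1 hkpos
  have hrich : ∀ q ∈ richPairs (p := p) n τ,
      (q.1 ≠ 0 ∧ q.2 ≠ 0) ∧ τ ≤ (powFiber n q.1 q.2).card := by
    intro q hq
    simpa [richPairs] using hq
  have hτn : τ ≤ n := (hrich q hq).2.trans (card_powFiber_le hn0 _ _)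
  have hnp1 : n ≤ p := by
    by_contra h
    push Not at h
    have : p ^ 3 < n ^ 3 := Nat.pow_lt_pow_left h (by norm_num)
    nlinarith [Nat.pow_le_pow_right hp1 (show 2 ≤ 3 by norm_num)]
  -- `A` is the largest admissible value of order `min τ (n ^ (2 / 3))`.
  obtain ⟨A, hA1, hAτ, hAn, hmax⟩ : ∃ A, 1 ≤ A ∧ 20 * A ≤ τ ∧ 16 * A ^ 3 ≤ n ^ 2 ∧
      (τ < 40 * A ∨ n ^ 2 < 128 * A ^ 3) := by
    have h1 : 20 * 1 ≤ τ ∧ 16 * 1 ^ 3 ≤ n ^ 2 := by constructor <;> nlinarith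
    have hle : 1 ≤ τ := by omega
    set A := Nat.findGreatest (fun A => 20 * A ≤ τ ∧ 16 * A ^ 3 ≤ n ^ 2) τ with hA
    have hspec := Nat.findGreatest_spec (P := fun A => 20 * A ≤ τ ∧ 16 * A ^ 3 ≤ n ^ 2) hle h1
    have hA1 : 1 ≤ A := Nat.le_findGreatest hle h1
    refine ⟨A, hA1, hspec.1, hspec.2, ?_⟩
    by_contra hcon
    push Not at hcon
    have : A + 1 ≤ A := by
      refine Nat.le_findGreatest (by omega) ⟨by omega, ?_⟩
      have h3 : (A + 1) ^ 3 ≤ (2 * A) ^ 3 := Nat.pow_le_pow_left (by omega) 3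
      nlinarith
    omega
  set B := n / A with hB
  have hAB : A * B ≤ n := Nat.mul_div_le n A
  have hAn' : A ≤ n := by omega
  have hB1 : 1 ≤ B := Nat.div_pos hAn' hA1
  have hn2 : n ≤ 2 * (A * B) := by
    have := Nat.lt_mul_div_succ n (show 0 < A by omega)
    rw [← hB] at this
    nlinarith
  have hAB2 : 4 * A ≤ B ^ 2 := by
    have h1 : n ^ 2 ≤ (2 * (A * B)) ^ 2 := Nat.pow_le_pow_left hn2 2
    have h2 : A ^ 2 * (4 * (4 * A)) ≤ A ^ 2 * (4 * B ^ 2) := by nlinarith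
    have h3 := Nat.le_of_mul_le_mul_left h2 (by positivity)
    omega
  have hA2p : 2 * A ≤ p := by
    by_contra h
    push Not at h
    have h1 : p ^ 3 < (2 * A) ^ 3 := Nat.pow_lt_pow_left h (by norm_num)
    have h2 : n ^ 2 ≤ p ^ 2 := Nat.pow_le_pow_left hnp1 2
    nlinarith [Nat.pow_le_pow_right hp1 (show 2 ≤ 3 by norm_num)]
  -- When `A` is of order `n ^ (2 / 3)`, this needs `p` to be large, which `2 ^ 31 ≤ τ ≤ n ≤ p` gives.
  have hpA : 2 * n ^ 2 ≤ p * A := by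
    rcases hmax with h | h
    · nlinarith
    · by_contra hcon
      push Not at hcon
      have h1 : (p * A) ^ 3 < (2 * n ^ 2) ^ 3 := Nat.pow_lt_pow_left hcon (by norm_num)
      have h2 : n ^ 2 * p ^ 3 < n ^ 2 * (2 ^ 10 * n ^ 4) := by
        have : p ^ 3 * n ^ 2 ≤ p ^ 3 * (128 * A ^ 3) := Nat.mul_le_mul_left _ h.le
        nlinarith
      have h3 : p ^ 3 < 2 ^ 10 * n ^ 4 := Nat.lt_of_mul_lt_mul_left h2
      have h4 : (p ^ 3) ^ 3 < (2 ^ 10 * n ^ 4) ^ 3 := Nat.pow_lt_pow_left h3 (by norm_num)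
      have h5 : (n ^ 3) ^ 4 ≤ (p ^ 2) ^ 4 := Nat.pow_le_pow_left hnp 4
      have h6 : p ^ 8 * p < p ^ 8 * 2 ^ 30 := by
        calc p ^ 8 * p = (p ^ 3) ^ 3 := by ring
          _ < (2 ^ 10 * n ^ 4) ^ 3 := h4
          _ = 2 ^ 30 * (n ^ 3) ^ 4 := by ring
          _ ≤ 2 ^ 30 * (p ^ 2) ^ 4 := Nat.mul_le_mul_left _ h5
          _ = p ^ 8 * 2 ^ 30 := by ring
      have h7 := Nat.lt_of_mul_lt_mul_left h6
      omega
  have hcond : A + n * B ≤ p := by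
    have h1 : A * (2 * (n * B)) ≤ A * p := by nlinarith
    have := Nat.le_of_mul_le_mul_left h1 (by omega)
    omega
  have hbound : ∀ T ⊆ richPairs (p := p) n τ, 2 * T.card * A < B ^ 2 →
      T.card * τ ≤ 1 + 4 * B ^ 2 := by
    intro T hT hcard
    have h1 := stepanov_bound hA1 hAB hcond T (fun q hq => (hrich q (hT hq)).1) hcard
    have h2 : T.card * τ ≤ ∑ q ∈ T, (powFiber n q.1 q.2).card := by
      rw [← smul_eq_mul]
      exact Finset.card_nsmul_le_sum _ _ _ fun q hq => (hrich q (hT hq)).2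
    have h3 : A * (T.card * τ) ≤ A * (1 + 4 * B ^ 2) := by nlinarith
    exact Nat.le_of_mul_le_mul_left h3 (by omega)
  -- A single rich fibre already bounds `τ`.
  have hτA : τ ≤ 640 * A := by
    have h1 := hbound {q} (by simpa using hq) (by simp; omega)
    rw [Finset.card_singleton, one_mul] at h1
    rcases hmax with h | h
    · omega
    · have h2 : A ^ 2 * τ ≤ A ^ 2 * (5 * B ^ 2) := Nat.mul_le_mul_left _ (by omega)
      have h3 : (A * B) ^ 2 ≤ n ^ 2 := Nat.pow_le_pow_left hAB 2
      have h4 : A ^ 2 * τ ≤ A ^ 2 * (640 * A) := by nlinarith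
      exact Nat.le_of_mul_le_mul_left h4 (by positivity)
  have hkA : 2 * k * A < B ^ 2 := by
    by_contra hcon
    push Not at hcon
    -- `k₀` is the largest number of fibres to which `hbound` applies.
    set k₀ := (B ^ 2 - 1) / (2 * A) with hk₀
    have h1 : 2 * A * k₀ ≤ B ^ 2 - 1 := Nat.mul_div_le _ _
    have h2 : B ^ 2 - 1 < 2 * A * (k₀ + 1) := Nat.lt_mul_div_succ _ (by omega)
    have hk₀k : k₀ ≤ k := by
      have h3 : 2 * A * k₀ ≤ 2 * A * k := by
        rw [show 2 * A * k = 2 * k * A by ring]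
        omega
      exact Nat.le_of_mul_le_mul_left h3 (by omega)
    obtain ⟨T, hT, hTk⟩ := Finset.exists_subset_card_eq hk₀k
    have hBpos : 1 ≤ B ^ 2 := Nat.one_le_pow _ _ hB1
    have h4 := hbound T hT (by
      rw [hTk, show 2 * k₀ * A = 2 * A * k₀ by ring]
      omega)
    rw [hTk] at h4
    clear hbound hrich
    have h5 : B ^ 2 ≤ 2 * A * (k₀ + 1) := by omega
    have hk₀1 : 1 ≤ k₀ := (Nat.le_div_iff_mul_le (by omega)).2 (by omega)
    have h6 : k₀ * (20 * A) ≤ k₀ * τ := Nat.mul_le_mul_left _ hAτ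
    have h7 : A * 1 ≤ A * k₀ := Nat.mul_le_mul_left _ hk₀1
    have h8 : 2 * A * (k₀ + 1) = 2 * (A * k₀) + 2 * A := by ring
    have h9 : k₀ * (20 * A) = 20 * (A * k₀) := by ring
    omega
  have h1 : τ ^ 3 ≤ (640 * A) ^ 3 := Nat.pow_le_pow_left hτA 3
  have h2 : (A * B) ^ 2 ≤ n ^ 2 := Nat.pow_le_pow_left hAB 2
  have h3 : A ^ 2 * (2 * k * A) ≤ A ^ 2 * B ^ 2 := Nat.mul_le_mul_left _ hkA.le
  calc k * τ ^ 3 ≤ k * (640 * A) ^ 3 := Nat.mul_le_mul_left _ h1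
    _ = 131072000 * (A ^ 2 * (2 * k * A)) := by ring
    _ ≤ 2 ^ 27 * n ^ 2 := by nlinarith

/-- The third moment of the rich fibres, by dyadic decomposition. -/
theorem sum_richPairs_card_pow_three_le {p : ℕ} [Fact p.Prime] {n K : ℕ} (hn : 0 < n)
    (hnp : n ^ 3 ≤ p ^ 2) (hK : 2 ^ 31 ≤ K) (hKp : 2 ^ 31 * n ^ 2 ≤ K * p) :
    ∑ q ∈ richPairs (p := p) n K, (powFiber n q.1 q.2).card ^ 3
      ≤ 2 ^ 30 * n ^ 2 * (Nat.log 2 n + 1) := by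
  have hmaps : ∀ q ∈ richPairs (p := p) n K,
      Nat.log 2 (powFiber n q.1 q.2).card ∈ Finset.range (Nat.log 2 n + 1) := by
    intro q _
    rw [Finset.mem_range, Nat.lt_succ_iff]
    exact Nat.log_mono_right (card_powFiber_le hn _ _)
  rw [← Finset.sum_fiberwise_of_maps_to hmaps]
  have hterm : ∀ j ∈ Finset.range (Nat.log 2 n + 1),
      ∑ q ∈ richPairs (p := p) n K with Nat.log 2 (powFiber n q.1 q.2).card = j,
        (powFiber n q.1 q.2).card ^ 3 ≤ 2 ^ 30 * n ^ 2 := by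
    intro j _
    -- The maximum keeps the threshold admissible in the lowest dyadic range.
    set τ := max K (2 ^ j) with hτ
    have hKτ : K ≤ τ := le_max_left _ _
    have hlevel := card_richPairs_mul_le (p := p) (n := n) (τ := τ) hn hnp (hK.trans hKτ)
      (hKp.trans (Nat.mul_le_mul_right _ hKτ))
    have hsub : (richPairs (p := p) n K).filter
        (fun q => Nat.log 2 (powFiber n q.1 q.2).card = j) ⊆ richPairs (p := p) n τ := by
      intro q hq
      simp only [richPairs, Finset.mem_filter, Finset.mem_univ, true_and] at hq ⊢
      refine ⟨hq.1.1, max_le hq.1.2 ?_⟩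
      rw [← hq.2]
      exact Nat.pow_log_le_self 2 (by omega)
    calc _ ≤ ∑ q ∈ richPairs (p := p) n K with Nat.log 2 (powFiber n q.1 q.2).card = j,
        8 * τ ^ 3 := by
          refine Finset.sum_le_sum fun q hq => ?_
          have hlog := (Finset.mem_filter.1 hq).2
          have h1 := Nat.lt_pow_succ_log_self (b := 2) (by norm_num) (powFiber n q.1 q.2).card
          rw [hlog] at h1
          have h2 : 2 ^ j ≤ τ := le_max_right _ _
          have h3 : (powFiber n q.1 q.2).card ≤ 2 * τ := by rw [pow_succ] at h1; omega
          calc _ ≤ (2 * τ) ^ 3 := Nat.pow_le_pow_left h3 3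
            _ = 8 * τ ^ 3 := by ring
      _ ≤ (richPairs (p := p) n τ).card * (8 * τ ^ 3) := by
          rw [Finset.sum_const, smul_eq_mul]
          exact Nat.mul_le_mul_right _ (Finset.card_le_card hsub)
      _ ≤ 2 ^ 30 * n ^ 2 := by nlinarith
  refine (Finset.sum_le_sum hterm).trans ?_
  rw [Finset.sum_const, Finset.card_range, smul_eq_mul, mul_comm]

/-! ### Exponential sums over a multiplicative subgroup -/

/-- A finite set of elements of `ZMod p` that is a subgroup of the multiplicative group. -/
structure IsMulSubgroup {p : ℕ} [Fact p.Prime] (H : Finset (ZMod p)) : Prop where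
  zero_notMem : (0 : ZMod p) ∉ H
  one_mem : (1 : ZMod p) ∈ H
  mul_mem : ∀ {x y}, x ∈ H → y ∈ H → x * y ∈ H
  inv_mem : ∀ {x}, x ∈ H → x⁻¹ ∈ H

namespace IsMulSubgroup

variable {p : ℕ} [Fact p.Prime] {H : Finset (ZMod p)}

theorem ne_zero (hH : IsMulSubgroup H) {x : ZMod p} (hx : x ∈ H) : x ≠ 0 :=
  fun h => hH.zero_notMem (h ▸ hx)

theorem card_pos (hH : IsMulSubgroup H) : 0 < H.card := Finset.card_pos.2 ⟨1, hH.one_mem⟩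

theorem card_lt (hH : IsMulSubgroup H) : H.card < p := by
  have h := Finset.card_lt_univ_of_notMem hH.zero_notMem
  rwa [ZMod.card] at h

theorem sum_mul_left {M : Type*} [AddCommMonoid M] (hH : IsMulSubgroup H) {g : ZMod p}
    (hg : g ∈ H) (f : ZMod p → M) : ∑ x ∈ H, f (g * x) = ∑ x ∈ H, f x := by
  refine Finset.sum_nbij' (fun x => g * x) (fun x => g⁻¹ * x) (fun x hx => hH.mul_mem hg hx)
    (fun x hx => hH.mul_mem (hH.inv_mem hg) hx) (fun x _ => ?_) (fun x _ => ?_) fun x _ => rfl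
  · exact inv_mul_cancel_left₀ (hH.ne_zero hg) x
  · exact mul_inv_cancel_left₀ (hH.ne_zero hg) x

theorem pow_card (hH : IsMulSubgroup H) {g : ZMod p} (hg : g ∈ H) : g ^ H.card = 1 := by
  have h : ∏ x ∈ H, g * x = ∏ x ∈ H, x := by
    refine Finset.prod_nbij' (fun x => g * x) (fun x => g⁻¹ * x) (fun x hx => hH.mul_mem hg hx)
      (fun x hx => hH.mul_mem (hH.inv_mem hg) hx) (fun x _ => ?_) (fun x _ => ?_) fun x _ => rfl
    · exact inv_mul_cancel_left₀ (hH.ne_zero hg) x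
    · exact mul_inv_cancel_left₀ (hH.ne_zero hg) x
  rw [Finset.prod_mul_distrib, Finset.prod_const] at h
  exact mul_eq_right₀ (Finset.prod_ne_zero_iff.2 fun x hx => hH.ne_zero hx) |>.1 h

end IsMulSubgroup

/-- The exponential sum over `H` at frequency `t`. -/
noncomputable def expSum {p : ℕ} [Fact p.Prime] (H : Finset (ZMod p)) (t : ZMod p) : ℂ :=
  ∑ x ∈ H, ZMod.stdAddChar (t * x)

section Fourier

variable {p : ℕ} [Fact p.Prime] {H : Finset (ZMod p)}

theorem sum_sum_stdAddChar {ι : Type*} (s : Finset ι) (f : ι → ZMod p) :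
    ∑ t : ZMod p, ∑ i ∈ s, (ZMod.stdAddChar (t * f i) : ℂ)
      = p * ((s.filter fun i => f i = 0).card : ℂ) := by
  rw [Finset.sum_comm, Finset.card_filter, Nat.cast_sum, Finset.mul_sum]
  refine Finset.sum_congr rfl fun i _ => ?_
  rw [AddChar.sum_mulShift _ (ZMod.isPrimitive_stdAddChar p), ZMod.card]
  split_ifs <;> simp

theorem expSum_zero : expSum H 0 = H.card := by
  simp [expSum]

theorem expSum_mul_mem (hH : IsMulSubgroup H) {g : ZMod p} (hg : g ∈ H) (t : ZMod p) :
    expSum H (t * g) = expSum H t := by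
  unfold expSum
  rw [← hH.sum_mul_left hg fun x => (ZMod.stdAddChar (t * x) : ℂ)]
  simp only [mul_assoc]

theorem sum_sq_norm_expSum : ∑ t, ‖expSum H t‖ ^ 2 = (p : ℝ) * H.card := by
  have h : ∀ t, ((‖expSum H t‖ ^ 2 : ℝ) : ℂ)
      = ∑ q ∈ H ×ˢ H, (ZMod.stdAddChar (t * (q.1 - q.2)) : ℂ) := by
    intro t
    rw [Complex.ofReal_pow, ← Complex.mul_conj', expSum, map_sum, Finset.sum_mul_sum,
      ← Finset.sum_product']
    refine Finset.sum_congr rfl fun q _ => ?_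
    rw [← AddChar.map_neg_eq_conj, ← AddChar.map_add_eq_mul]
    congr 1
    ring
  have h2 : ((∑ t, ‖expSum H t‖ ^ 2 : ℝ) : ℂ) = (p : ℂ) * H.card := by
    rw [Complex.ofReal_sum, Finset.sum_congr rfl fun t _ => h t,
      sum_sum_stdAddChar (H ×ˢ H) fun q => q.1 - q.2]
    congr 2
    have : (H ×ˢ H).filter (fun q => q.1 - q.2 = 0) = H.diag := by
      ext ⟨a, b⟩
      simp only [Finset.mem_filter, Finset.mem_product, Finset.mem_diag, sub_eq_zero]
      constructor
      · rintro ⟨⟨ha, _⟩, rfl⟩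
        exact ⟨ha, rfl⟩
      · rintro ⟨ha, rfl⟩
        exact ⟨⟨ha, ha⟩, rfl⟩
    rw [this, Finset.diag_card]
  exact_mod_cast h2

theorem sum_erase_sq_norm_expSum :
    ∑ t ∈ Finset.univ.erase 0, ‖expSum H t‖ ^ 2 = (p : ℝ) * H.card - (H.card : ℝ) ^ 2 := by
  rw [Finset.sum_erase_eq_sub (Finset.mem_univ _), sum_sq_norm_expSum, expSum_zero,
    Complex.norm_natCast]

theorem sum_erase_mul_left {M : Type*} [AddCommMonoid M] {a : ZMod p} (ha : a ≠ 0)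
    (f : ZMod p → M) :
    ∑ t ∈ Finset.univ.erase 0, f (a * t) = ∑ t ∈ Finset.univ.erase 0, f t := by
  refine Finset.sum_nbij' (fun x => a * x) (fun x => a⁻¹ * x) ?_ ?_ ?_ ?_ fun x _ => rfl
  · intro x hx
    simpa [ha] using hx
  · intro x hx
    simpa [ha] using hx
  · intro x _
    exact inv_mul_cancel_left₀ ha x
  · intro x _
    exact mul_inv_cancel_left₀ ha x

/-- Each nonzero frequency shares its value with the `|H|` frequencies of its `H`-orbit, so
Parseval bounds it. -/
theorem sq_norm_expSum_le (hH : IsMulSubgroup H) {t : ZMod p} (ht : t ≠ 0) :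
    ‖expSum H t‖ ^ 2 ≤ p - H.card := by
  have hn : (0 : ℝ) < H.card := by exact_mod_cast hH.card_pos
  have h1 : ∑ g ∈ H, ‖expSum H (t * g)‖ ^ 2 = H.card * ‖expSum H t‖ ^ 2 := by
    rw [Finset.sum_congr rfl fun g hg => by rw [expSum_mul_mem hH hg], Finset.sum_const,
      nsmul_eq_mul]
  have h2 : ∑ g ∈ H, ‖expSum H (t * g)‖ ^ 2 ≤ ∑ s ∈ Finset.univ.erase 0, ‖expSum H s‖ ^ 2 := by
    rw [← sum_erase_mul_left ht (fun s => ‖expSum H s‖ ^ 2)]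
    refine Finset.sum_le_sum_of_subset_of_nonneg ?_ fun _ _ _ => by positivity
    intro g hg
    simpa using hH.ne_zero hg
  rw [h1, sum_erase_sq_norm_expSum] at h2
  have h3 : (H.card : ℝ) * ‖expSum H t‖ ^ 2 ≤ H.card * (p - H.card) := by linarith
  exact le_of_mul_le_mul_left h3 hn

/-- Solutions in `H` of the homogeneous equation with coefficients `a, b, c, d`. -/
def quadSolutions (H : Finset (ZMod p)) (a b c d : ZMod p) :
    Finset ((ZMod p × ZMod p) × (ZMod p × ZMod p)) :=
  ((H ×ˢ H) ×ˢ (H ×ˢ H)).filter fun q =>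
    (a * q.1.1 + b * q.1.2) + (c * q.2.1 + d * q.2.2) = 0

/-- The expected number of solutions is `|H| ^ 4 / p`. Four factors allow the error to be bounded by
the fourth moment of the nontrivial exponential sums, hence by Parseval and their maximum. -/
theorem le_card_quadSolutions (hH : IsMulSubgroup H) {a b c d : ZMod p} (ha : a ≠ 0) (hb : b ≠ 0)
    (hc : c ≠ 0) (hd : d ≠ 0) :
    (H.card : ℝ) ^ 4 - H.card * (p - H.card) ^ 2 ≤ p * (quadSolutions H a b c d).card := by
  have hprod : ∀ t, ∑ q ∈ (H ×ˢ H) ×ˢ (H ×ˢ H), (ZMod.stdAddChar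
      (t * ((a * q.1.1 + b * q.1.2) + (c * q.2.1 + d * q.2.2))) : ℂ)
      = (expSum H (a * t) * expSum H (b * t)) * (expSum H (c * t) * expSum H (d * t)) := by
    intro t
    simp only [expSum]
    rw [Finset.sum_mul_sum, Finset.sum_mul_sum, ← Finset.sum_product', ← Finset.sum_product',
      Finset.sum_mul_sum, ← Finset.sum_product']
    refine Finset.sum_congr rfl fun q _ => ?_
    simp only [← AddChar.map_add_eq_mul]
    congr 1
    ring
  have hcount := sum_sum_stdAddChar ((H ×ˢ H) ×ˢ (H ×ˢ H))
    (fun q => (a * q.1.1 + b * q.1.2) + (c * q.2.1 + d * q.2.2))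
  rw [Finset.sum_congr rfl fun t _ => hprod t,
    ← Finset.add_sum_erase _ _ (Finset.mem_univ (0 : ZMod p))] at hcount
  simp only [mul_zero, expSum_zero] at hcount
  have hfour : ∀ e : ZMod p, e ≠ 0 → ∑ t ∈ Finset.univ.erase 0, ‖expSum H (e * t)‖ ^ 4
      ≤ H.card * ((p : ℝ) - H.card) ^ 2 := by
    intro e he
    rw [sum_erase_mul_left he (fun t => ‖expSum H t‖ ^ 4)]
    calc ∑ t ∈ Finset.univ.erase 0, ‖expSum H t‖ ^ 4
        ≤ ∑ t ∈ Finset.univ.erase 0, ((p : ℝ) - H.card) * ‖expSum H t‖ ^ 2 := by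
          refine Finset.sum_le_sum fun t ht => ?_
          have := sq_norm_expSum_le hH (Finset.ne_of_mem_erase ht)
          calc ‖expSum H t‖ ^ 4 = ‖expSum H t‖ ^ 2 * ‖expSum H t‖ ^ 2 := by ring
            _ ≤ _ := mul_le_mul_of_nonneg_right this (by positivity)
      _ = H.card * ((p : ℝ) - H.card) ^ 2 := by
          rw [← Finset.mul_sum, sum_erase_sq_norm_expSum]
          ring
  have herr : ‖∑ t ∈ Finset.univ.erase 0, (expSum H (a * t) * expSum H (b * t)) *
      (expSum H (c * t) * expSum H (d * t))‖ ≤ H.card * ((p : ℝ) - H.card) ^ 2 := by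
    refine (norm_sum_le _ _).trans ?_
    calc _ ≤ ∑ t ∈ Finset.univ.erase 0, (‖expSum H (a * t)‖ ^ 4 + ‖expSum H (b * t)‖ ^ 4 +
          ‖expSum H (c * t)‖ ^ 4 + ‖expSum H (d * t)‖ ^ 4) / 4 := by
          refine Finset.sum_le_sum fun t _ => ?_
          simp only [norm_mul]
          set u := ‖expSum H (a * t)‖
          set v := ‖expSum H (b * t)‖
          set w := ‖expSum H (c * t)‖
          set z := ‖expSum H (d * t)‖
          -- the inequality between the geometric and the arithmetic mean of four fourth powers
          nlinarith [sq_nonneg (u * v - w * z), sq_nonneg (u ^ 2 - v ^ 2),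
            sq_nonneg (w ^ 2 - z ^ 2)]
      _ ≤ _ := by
          rw [← Finset.sum_div, Finset.sum_add_distrib, Finset.sum_add_distrib,
            Finset.sum_add_distrib]
          linarith [hfour a ha, hfour b hb, hfour c hc, hfour d hd]
  set E := ∑ t ∈ Finset.univ.erase 0, (expSum H (a * t) * expSum H (b * t)) *
      (expSum H (c * t) * expSum H (d * t)) with hE
  have hre := congrArg Complex.re hcount
  have hEre : -(H.card * ((p : ℝ) - H.card) ^ 2) ≤ E.re :=
    (neg_le_neg herr).trans (neg_le_of_abs_le (Complex.abs_re_le_norm E))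
  have hre' : (H.card : ℝ) ^ 4 + E.re = p * (quadSolutions H a b c d).card := by
    have h1 : ((H.card : ℂ) * H.card * (H.card * H.card)) = ((H.card ^ 4 : ℕ) : ℂ) := by
      push_cast; ring
    rw [h1, ← Nat.cast_mul, Complex.add_re, Complex.natCast_re, Complex.natCast_re] at hre
    push_cast at hre
    exact hre
  linarith

/-- The number of points of `H × H` on the line `a x + b y = 1`. -/
def lineCount (H : Finset (ZMod p)) (a b : ZMod p) : ℕ :=
  ((H ×ˢ H).filter fun q => a * q.1 + b * q.2 = 1).card

theorem lineCount_mul_mem_eq (hH : IsMulSubgroup H) {g h : ZMod p} (hg : g ∈ H) (hh : h ∈ H)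
    (a b : ZMod p) : lineCount H (a * g) (b * h) = lineCount H a b := by
  unfold lineCount
  rw [Finset.card_filter, Finset.card_filter, Finset.sum_product, Finset.sum_product,
    ← hH.sum_mul_left hg (fun x => ∑ y ∈ H, if a * x + b * y = 1 then 1 else 0)]
  refine Finset.sum_congr rfl fun x _ => ?_
  rw [← hH.sum_mul_left hh fun y => if a * (g * x) + b * y = 1 then 1 else 0]
  exact Finset.sum_congr rfl fun y _ => by simp only [mul_assoc]

/-- Square root cancellation for a line: the `H`-invariance of the equation `a x + b y = z` lets a
third exponential sum enter. -/
theorem lineCount_le_add_sqrt (hH : IsMulSubgroup H) {a b : ZMod p} (ha : a ≠ 0) (hb : b ≠ 0) :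
    (lineCount H a b : ℝ) ≤ (H.card : ℝ) ^ 2 / p + √p := by
  have hp : (0 : ℝ) < p := by exact_mod_cast (Fact.out : p.Prime).pos
  have hn : (0 : ℝ) < H.card := by exact_mod_cast hH.card_pos
  have hprod : ∀ t, ∑ q ∈ H ×ˢ (H ×ˢ H), (ZMod.stdAddChar
      (t * (a * q.2.1 + b * q.2.2 - q.1)) : ℂ)
      = expSum H (-1 * t) * (expSum H (a * t) * expSum H (b * t)) := by
    intro t
    simp only [expSum]
    rw [Finset.sum_mul_sum, ← Finset.sum_product', Finset.sum_mul_sum, ← Finset.sum_product']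
    refine Finset.sum_congr rfl fun q _ => ?_
    simp only [← AddChar.map_add_eq_mul]
    congr 1
    ring
  have hcount := sum_sum_stdAddChar (H ×ˢ (H ×ˢ H)) (fun q => a * q.2.1 + b * q.2.2 - q.1)
  have hcard : ((H ×ˢ (H ×ˢ H)).filter fun q => a * q.2.1 + b * q.2.2 - q.1 = 0).card
      = H.card * lineCount H a b := by
    rw [Finset.card_filter, Finset.sum_product, ← smul_eq_mul, ← Finset.sum_const]
    refine Finset.sum_congr rfl fun z hz => ?_
    rw [← lineCount_mul_mem_eq hH (hH.inv_mem hz) (hH.inv_mem hz), lineCount, Finset.card_filter]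
    refine Finset.sum_congr rfl fun q _ => ?_
    have hz0 := hH.ne_zero hz
    refine if_congr ?_ rfl rfl
    rw [sub_eq_zero, ← mul_right_inj' (inv_ne_zero hz0), inv_mul_cancel₀ hz0]
    rw [show z⁻¹ * (a * q.1 + b * q.2) = a * z⁻¹ * q.1 + b * z⁻¹ * q.2 by ring]
  rw [hcard, Finset.sum_congr rfl fun t _ => hprod t,
    ← Finset.add_sum_erase _ _ (Finset.mem_univ (0 : ZMod p))] at hcount
  simp only [mul_zero, expSum_zero] at hcount
  have htwo : ∀ e : ZMod p, e ≠ 0 → ∑ t ∈ Finset.univ.erase 0, ‖expSum H (e * t)‖ ^ 2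
      ≤ p * H.card := by
    intro e he
    rw [sum_erase_mul_left he (fun t => ‖expSum H t‖ ^ 2), sum_erase_sq_norm_expSum]
    nlinarith
  set E := ∑ t ∈ Finset.univ.erase 0, expSum H (-1 * t) * (expSum H (a * t) * expSum H (b * t))
    with hE
  have herr : ‖E‖ ≤ √p * (p * H.card) := by
    refine (norm_sum_le _ _).trans ?_
    calc _ ≤ ∑ t ∈ Finset.univ.erase 0,
          √p * ((‖expSum H (a * t)‖ ^ 2 + ‖expSum H (b * t)‖ ^ 2) / 2) := by
          refine Finset.sum_le_sum fun t ht => ?_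
          simp only [norm_mul]
          have h1 := sq_norm_expSum_le hH (t := -1 * t)
            (mul_ne_zero (by simp) (Finset.ne_of_mem_erase ht))
          have h2 : ‖expSum H (-1 * t)‖ ≤ √p := Real.le_sqrt_of_sq_le (by linarith)
          refine mul_le_mul h2 ?_ (by positivity) (by positivity)
          nlinarith [sq_nonneg (‖expSum H (a * t)‖ - ‖expSum H (b * t)‖)]
      _ ≤ _ := by
          rw [← Finset.mul_sum, ← Finset.sum_div, Finset.sum_add_distrib]
          exact mul_le_mul_of_nonneg_left (by linarith [htwo a ha, htwo b hb]) (by positivity)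
  have hre := congrArg Complex.re hcount
  have h1 : ((H.card : ℂ) * (H.card * H.card)) = ((H.card ^ 3 : ℕ) : ℂ) := by
    push_cast; ring
  rw [h1, ← Nat.cast_mul, Complex.add_re, Complex.natCast_re, Complex.natCast_re] at hre
  push_cast at hre
  have hEre := (le_abs_self _).trans ((Complex.abs_re_le_norm E).trans herr)
  have h2 : (H.card * p : ℝ) * lineCount H a b
      ≤ (H.card * p : ℝ) * ((H.card : ℝ) ^ 2 / p + √p) := by
    have : (H.card * p : ℝ) * ((H.card : ℝ) ^ 2 / p + √p)
        = (H.card : ℝ) ^ 3 + √p * (p * H.card) := by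
      field_simp
    rw [this]
    linarith
  exact le_of_mul_le_mul_left h2 (by positivity)

end Fourier

/-! ### Moments of line counts -/

section Moments

variable {p : ℕ} [Fact p.Prime] {H : Finset (ZMod p)}

/-- The pairs `(a, b)` with `a, b ≠ 0`, parametrising the lines `a x + b y = 1` that are neither
horizontal nor vertical. -/
def unitPairs (p : ℕ) [Fact p.Prime] : Finset (ZMod p × ZMod p) :=
  Finset.univ.erase 0 ×ˢ Finset.univ.erase 0

theorem mem_unitPairs {q : ZMod p × ZMod p} : q ∈ unitPairs p ↔ q.1 ≠ 0 ∧ q.2 ≠ 0 := by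
  simp [unitPairs]

theorem card_unitPairs : (unitPairs p).card = (p - 1) ^ 2 := by
  simp [unitPairs, Finset.card_erase_of_mem, ZMod.card, sq]

theorem sum_unitPairs_mul {M : Type*} [AddCommMonoid M] {g h : ZMod p} (hg : g ≠ 0) (hh : h ≠ 0)
    (f : ZMod p → ZMod p → M) :
    ∑ q ∈ unitPairs p, f (q.1 * g) (q.2 * h) = ∑ q ∈ unitPairs p, f q.1 q.2 := by
  unfold unitPairs
  rw [Finset.sum_product, Finset.sum_product,
    ← sum_erase_mul_left hg fun a => ∑ b ∈ Finset.univ.erase 0, f a b]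
  refine Finset.sum_congr rfl fun a _ => ?_
  rw [← sum_erase_mul_left hh fun b => f (g * a) b]
  exact Finset.sum_congr rfl fun b _ => by rw [mul_comm a, mul_comm b]

theorem card_lines_through {x y : ZMod p} (hx : x ≠ 0) (hy : y ≠ 0) :
    ((unitPairs p).filter fun q => q.1 * x + q.2 * y = 1).card = p - 2 := by
  have h : ((Finset.univ.erase (0 : ZMod p)).erase x⁻¹).card = p - 2 := by
    rw [Finset.card_erase_of_mem (by simpa using hx), Finset.card_erase_of_mem (Finset.mem_univ _),
      Finset.card_univ, ZMod.card]
    omega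
  rw [← h]
  refine Finset.card_nbij' (fun q => q.1) (fun a => (a, (1 - a * x) / y)) ?_ ?_ ?_ ?_
  · intro q hq
    simp only [Finset.coe_filter, mem_unitPairs, Set.mem_ofPred_eq] at hq
    simp only [Finset.coe_erase, Finset.coe_univ, Set.mem_sdiff, Set.mem_univ, true_and,
      Set.mem_singleton_iff]
    refine ⟨hq.1.1, fun h0 => ?_⟩
    rw [h0, inv_mul_cancel₀ hx, add_eq_left] at hq
    exact mul_ne_zero hq.1.2 hy hq.2
  · intro a ha
    simp only [Finset.coe_erase, Finset.coe_univ, Set.mem_sdiff, Set.mem_univ, true_and,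
      Set.mem_singleton_iff] at ha
    simp only [Finset.coe_filter, mem_unitPairs, Set.mem_ofPred_eq]
    refine ⟨⟨ha.1, div_ne_zero (fun h0 => ha.2 ?_) hy⟩, by field_simp; ring⟩
    exact eq_inv_of_mul_eq_one_left (sub_eq_zero.1 h0).symm
  · intro q hq
    simp only [Finset.coe_filter, mem_unitPairs, Set.mem_ofPred_eq] at hq
    refine Prod.ext rfl ?_
    simp only
    rw [div_eq_iff hy]
    linear_combination -hq.2
  · intro a _
    rfl

theorem card_lines_through_two_le {x y x' y' : ZMod p} (hx : x ≠ 0) (h : (x, y) ≠ (x', y')) :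
    ((unitPairs p).filter fun q => q.1 * x + q.2 * y = 1 ∧ q.1 * x' + q.2 * y' = 1).card ≤ 1 := by
  rw [Finset.card_le_one]
  rintro ⟨a, b⟩ hq ⟨c, d⟩ hr
  simp only [Finset.mem_filter, mem_unitPairs] at hq hr
  obtain ⟨_, h1, h2⟩ := hq
  obtain ⟨_, h3, h4⟩ := hr
  have hdet : x * y' - x' * y ≠ 0 := by
    intro h0
    apply h
    have h5 : x' = x := by
      linear_combination x * h2 - x' * h1 - b * h0
    have h6 : y' = y := by
      rw [h5, ← mul_sub, mul_eq_zero, or_iff_right hx] at h0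
      exact sub_eq_zero.1 h0
    rw [h5, h6]
  have h7 : (a - c) * (x * y' - x' * y) = 0 := by
    linear_combination y' * (h1 - h3) - y * (h2 - h4)
  have h8 : (b - d) * (x * y' - x' * y) = 0 := by
    linear_combination x * (h2 - h4) - x' * (h1 - h3)
  rw [mul_eq_zero, or_iff_left hdet, sub_eq_zero] at h7 h8
  rw [h7, h8]

theorem sum_lineCount (hH : IsMulSubgroup H) :
    ∑ q ∈ unitPairs p, lineCount H q.1 q.2 = H.card ^ 2 * (p - 2) := by
  simp only [lineCount, Finset.card_filter]
  rw [Finset.sum_comm]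
  simp only [← Finset.card_filter]
  rw [Finset.sum_congr rfl fun z hz => card_lines_through
    (hH.ne_zero (Finset.mem_product.1 hz).1) (hH.ne_zero (Finset.mem_product.1 hz).2)]
  simp [sq]

/-- Two distinct points of `H × H` lie on at most one of the lines `a x + b y = 1`. -/
theorem sum_sq_lineCount_le (hH : IsMulSubgroup H) :
    ∑ q ∈ unitPairs p, lineCount H q.1 q.2 ^ 2 ≤ H.card ^ 4 + H.card ^ 2 * p := by
  have h1 : ∀ q : ZMod p × ZMod p, lineCount H q.1 q.2 ^ 2
      = ∑ z ∈ (H ×ˢ H) ×ˢ (H ×ˢ H), if q.1 * z.1.1 + q.2 * z.1.2 = 1 ∧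
        q.1 * z.2.1 + q.2 * z.2.2 = 1 then 1 else 0 := by
    intro q
    rw [lineCount, Finset.card_filter, sq, Finset.sum_mul_sum, ← Finset.sum_product']
    refine Finset.sum_congr rfl fun z _ => ?_
    by_cases ha : q.1 * z.1.1 + q.2 * z.1.2 = 1 <;>
      by_cases hb : q.1 * z.2.1 + q.2 * z.2.2 = 1 <;> simp [ha, hb]
  rw [Finset.sum_congr rfl fun q _ => h1 q, Finset.sum_comm]
  simp only [← Finset.card_filter]
  calc _ ≤ ∑ z ∈ (H ×ˢ H) ×ˢ (H ×ˢ H), (1 + if z.1 = z.2 then p else 0) := by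
        refine Finset.sum_le_sum fun z hz => ?_
        simp only [Finset.mem_product] at hz
        by_cases hzz : z.1 = z.2
        · simp only [hzz, and_self, if_true]
          rw [card_lines_through (hH.ne_zero hz.2.1) (hH.ne_zero hz.2.2)]
          omega
        · rw [if_neg hzz, add_zero]
          exact card_lines_through_two_le (hH.ne_zero hz.1.1) hzz
    _ = H.card ^ 4 + H.card ^ 2 * p := by
        rw [Finset.sum_add_distrib, Finset.sum_product (f := fun z => if z.1 = z.2 then p else 0)]
        simp only [Finset.sum_ite_eq]
        rw [Finset.sum_ite_mem, Finset.inter_self]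
        simp only [Finset.sum_const, Finset.card_product, smul_eq_mul]
        ring

/-- Second moment of the deviation of `lineCount` from its expected value `|H| ^ 2 / p`. -/
theorem sum_sq_lineCount_sub_le (hH : IsMulSubgroup H) :
    ∑ q ∈ unitPairs p, ((lineCount H q.1 q.2 : ℝ) - (H.card : ℝ) ^ 2 / p) ^ 2
      ≤ 5 * (H.card : ℝ) ^ 2 * p := by
  have hp2 : 2 ≤ p := (Fact.out : p.Prime).two_le
  have hp : (2 : ℝ) ≤ p := by exact_mod_cast hp2
  have hn : (H.card : ℝ) ≤ p := by exact_mod_cast hH.card_lt.le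
  set n : ℝ := (H.card : ℝ) with hndef
  have hn0 : 0 ≤ n := Nat.cast_nonneg _
  have h1 : (∑ q ∈ unitPairs p, (lineCount H q.1 q.2 : ℝ)) = n ^ 2 * (p - 2) := by
    have := congrArg (Nat.cast (R := ℝ)) (sum_lineCount hH)
    push_cast [Nat.cast_sub hp2] at this
    exact this
  have h2 : (∑ q ∈ unitPairs p, (lineCount H q.1 q.2 : ℝ) ^ 2) ≤ n ^ 4 + n ^ 2 * p := by
    have := sum_sq_lineCount_le hH
    rw [← Nat.cast_le (α := ℝ)] at this
    push_cast at this
    exact this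
  have h3 : ∑ q ∈ unitPairs p, ((lineCount H q.1 q.2 : ℝ) - n ^ 2 / p) ^ 2
      = (∑ q ∈ unitPairs p, (lineCount H q.1 q.2 : ℝ) ^ 2)
        - 2 * (n ^ 2 / p) * (∑ q ∈ unitPairs p, (lineCount H q.1 q.2 : ℝ))
        + ((p : ℝ) - 1) ^ 2 * (n ^ 2 / p) ^ 2 := by
    have hc : ((unitPairs p).card : ℝ) = ((p : ℝ) - 1) ^ 2 := by
      rw [card_unitPairs]
      push_cast [Nat.cast_sub (show 1 ≤ p by omega)]
      rfl
    rw [← hc, Finset.mul_sum, ← nsmul_eq_mul, ← Finset.sum_const, ← Finset.sum_sub_distrib,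
      ← Finset.sum_add_distrib]
    exact Finset.sum_congr rfl fun q _ => by ring
  rw [h3, h1]
  have h4 : ((p : ℝ) - 1) ^ 2 * (n ^ 2 / p) ^ 2 ≤ n ^ 4 := by
    have : ((p : ℝ) - 1) ^ 2 * (n ^ 2 / p) ^ 2 = (((p : ℝ) - 1) / p) ^ 2 * n ^ 4 := by
      field_simp
    rw [this]
    have h5 : (((p : ℝ) - 1) / p) ^ 2 ≤ 1 := by
      apply pow_le_one₀
      · exact div_nonneg (by linarith) (by linarith)
      · rw [div_le_one (by linarith)]; linarith
    exact mul_le_of_le_one_left (by positivity) h5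
  have h6 : 2 * (n ^ 2 / p) * (n ^ 2 * (p - 2)) = 2 * n ^ 4 - 4 * (n ^ 4 / p) := by
    field_simp
    ring
  have h7 : n ^ 4 / p ≤ n ^ 2 * p := by
    rw [div_le_iff₀ (by linarith)]
    have : n ^ 2 ≤ p ^ 2 := pow_le_pow_left₀ hn0 hn 2
    nlinarith [mul_le_mul_of_nonneg_left this (sq_nonneg n)]
  linarith

theorem lineCount_le_card_powFiber (hH : IsMulSubgroup H) {a b : ZMod p} (ha : a ≠ 0)
    (hb : b ≠ 0) :
    lineCount H a b ≤ (powFiber H.card (a ^ H.card) (b ^ H.card)).card := by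
  refine Finset.card_le_card_of_injOn (fun q => a * q.1) ?_ ?_
  · intro q hq
    simp only [Finset.coe_filter, Finset.mem_product, Set.mem_ofPred_eq] at hq
    simp only [powFiber, Finset.coe_filter, Finset.mem_univ, true_and, Set.mem_ofPred_eq]
    rw [← hq.2, add_sub_cancel_left, mul_pow, mul_pow, hH.pow_card hq.1.1, hH.pow_card hq.1.2]
    simp
  · intro q hq r hr hqr
    simp only [Finset.coe_filter, Finset.mem_product, Set.mem_ofPred_eq] at hq hr hqr
    have h2 : b * q.2 = b * r.2 := by linear_combination hq.2 - hr.2 - hqr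
    exact Prod.ext (mul_left_cancel₀ ha hqr) (mul_left_cancel₀ hb h2)

/-- Third moment of the rich lines. A pair `(a, b)` of `n`-th powers comes from at most `n ^ 2`
lines. -/
theorem sum_rich_lineCount_pow_three_le (hH : IsMulSubgroup H) {K : ℕ}
    (hnp : H.card ^ 3 ≤ p ^ 2) (hK : 2 ^ 31 ≤ K) (hKp : 2 ^ 31 * H.card ^ 2 ≤ K * p) :
    ∑ q ∈ unitPairs p with K ≤ lineCount H q.1 q.2, lineCount H q.1 q.2 ^ 3
      ≤ H.card ^ 2 * (2 ^ 30 * H.card ^ 2 * (Nat.log 2 H.card + 1)) := by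
  set n := H.card with hn
  have hn0 : 0 < n := hH.card_pos
  have hmaps : ∀ q ∈ (unitPairs p).filter (fun q => K ≤ lineCount H q.1 q.2),
      (q.1 ^ n, q.2 ^ n) ∈ richPairs (p := p) n K := by
    intro q hq
    simp only [Finset.mem_filter, mem_unitPairs] at hq
    simp only [richPairs, Finset.mem_filter, Finset.mem_univ, true_and]
    exact ⟨⟨pow_ne_zero _ hq.1.1, pow_ne_zero _ hq.1.2⟩,
      hq.2.trans (lineCount_le_card_powFiber hH hq.1.1 hq.1.2)⟩
  rw [← Finset.sum_fiberwise_of_maps_to hmaps]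
  refine le_trans ?_ (Nat.mul_le_mul_left _ (sum_richPairs_card_pow_three_le hn0 hnp hK hKp))
  rw [Finset.mul_sum]
  refine Finset.sum_le_sum fun z _ => ?_
  have hfib : (((unitPairs p).filter (fun q => K ≤ lineCount H q.1 q.2)).filter
      fun q => (q.1 ^ n, q.2 ^ n) = z).card ≤ n ^ 2 := by
    have hsub : ((unitPairs p).filter (fun q => K ≤ lineCount H q.1 q.2)).filter
        (fun q => (q.1 ^ n, q.2 ^ n) = z) ⊆
        (Polynomial.nthRoots n z.1).toFinset ×ˢ (Polynomial.nthRoots n z.2).toFinset := by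
      intro q hq
      have := (Finset.mem_filter.1 hq).2
      simp only [Finset.mem_product, Multiset.mem_toFinset, Polynomial.mem_nthRoots hn0]
      rw [← this]
      exact ⟨rfl, rfl⟩
    refine (Finset.card_le_card hsub).trans ?_
    rw [Finset.card_product, sq]
    exact Nat.mul_le_mul
      ((Multiset.toFinset_card_le _).trans (Polynomial.card_nthRoots n _))
      ((Multiset.toFinset_card_le _).trans (Polynomial.card_nthRoots n _))
  refine le_trans ?_ (Nat.mul_le_mul_right _ hfib)
  rw [← smul_eq_mul, ← Finset.sum_const]
  refine Finset.sum_le_sum fun q hq => ?_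
  simp only [Finset.mem_filter, mem_unitPairs] at hq
  rw [← hq.2]
  exact Nat.pow_le_pow_left (lineCount_le_card_powFiber hH hq.1.1.1 hq.1.1.2) 3

/-- The number of points of `H × H` on the line of slope `t` through `(l, m)`, the first
coordinate being the dependent one. -/
def slopeCount (H : Finset (ZMod p)) (l m t : ZMod p) : ℕ :=
  ((H ×ˢ H).filter fun q => q.1 - l = t * (q.2 - m)).card

theorem slopeCount_le (l m t : ZMod p) : slopeCount H l m t ≤ H.card := by
  refine Finset.card_le_card_of_injOn (fun q => q.2) ?_ ?_
  · intro q hq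
    simp only [Finset.coe_filter, Finset.mem_product, Set.mem_ofPred_eq] at hq
    exact hq.1.2
  · intro q hq r hr hqr
    simp only [Finset.coe_filter, Finset.mem_product, Set.mem_ofPred_eq] at hq hr hqr
    refine Prod.ext ?_ hqr
    have := hq.2
    rw [hqr, ← hr.2] at this
    exact sub_left_injective this

theorem slopeCount_eq_lineCount {l m t : ZMod p} (h : l - t * m ≠ 0) :
    slopeCount H l m t = lineCount H (1 / (l - t * m)) (-t / (l - t * m)) := by
  unfold slopeCount lineCount
  congr 1
  refine Finset.filter_congr fun q _ => ?_
  rw [div_mul_eq_mul_div, div_mul_eq_mul_div, ← add_div, div_eq_one_iff_eq h]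
  constructor <;> intro h1 <;> linear_combination h1

/-- Averaging over the translates of `(l, m)` by `H × H`: sums over the lines through one point
become sums over all lines, weighted by the number of translates they contain. -/
theorem sum_slopeCount_eq (hH : IsMulSubgroup H) {l m : ZMod p} (hm : m ≠ 0)
    (f : ℕ → ℝ) :
    (H.card : ℝ) ^ 2 * ∑ t ∈ (Finset.univ.erase 0).erase (l / m), f (slopeCount H l m t)
      = ∑ q ∈ unitPairs p, f (lineCount H q.1 q.2) * lineCount H (q.1 * l) (q.2 * m) := by
  have h1 : ∑ t ∈ (Finset.univ.erase 0).erase (l / m), f (slopeCount H l m t)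
      = ∑ q ∈ unitPairs p, if q.1 * l + q.2 * m = 1 then f (lineCount H q.1 q.2) else 0 := by
    rw [← Finset.sum_filter]
    refine Finset.sum_nbij' (fun t => (1 / (l - t * m), -t / (l - t * m)))
      (fun q => -q.2 / q.1) ?_ ?_ ?_ ?_ ?_
    · intro t ht
      simp only [Finset.mem_erase, Finset.mem_univ, and_true, ne_eq, eq_div_iff hm] at ht
      have h0 : l - t * m ≠ 0 := fun h => ht.1 (sub_eq_zero.1 h).symm
      simp only [Finset.mem_filter, mem_unitPairs]
      refine ⟨⟨one_div_ne_zero h0, div_ne_zero (neg_ne_zero.2 ht.2) h0⟩, ?_⟩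
      field_simp
      ring
    · intro q hq
      simp only [Finset.mem_filter, mem_unitPairs] at hq
      simp only [Finset.mem_erase, Finset.mem_univ, and_true, ne_eq]
      refine ⟨fun h => ?_, div_ne_zero (neg_ne_zero.2 hq.1.2) hq.1.1⟩
      rw [div_eq_div_iff hq.1.1 hm] at h
      have : q.1 * l + q.2 * m = 0 := by linear_combination -h
      rw [hq.2] at this
      exact one_ne_zero this
    · intro t ht
      simp only [Finset.mem_erase, Finset.mem_univ, and_true, ne_eq, eq_div_iff hm] at ht
      have h0 : l - t * m ≠ 0 := fun h => ht.1 (sub_eq_zero.1 h).symm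
      field_simp
    · intro q hq
      simp only [Finset.mem_filter, mem_unitPairs] at hq
      have h0 : l - -q.2 / q.1 * m = 1 / q.1 := by
        have := hq.1.1
        field_simp
        linear_combination hq.2
      have := hq.1.1
      simp only [h0]
      refine Prod.ext ?_ ?_ <;> simp only <;> field_simp
    · intro t ht
      simp only [Finset.mem_erase, Finset.mem_univ, and_true, ne_eq, eq_div_iff hm] at ht
      have h0 : l - t * m ≠ 0 := fun h => ht.1 (sub_eq_zero.1 h).symm
      rw [slopeCount_eq_lineCount h0]
  have h2 : ∀ z ∈ H ×ˢ H, ∑ q ∈ unitPairs p,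
      (if q.1 * l * z.1 + q.2 * m * z.2 = 1 then f (lineCount H q.1 q.2) else 0)
      = ∑ q ∈ unitPairs p, if q.1 * l + q.2 * m = 1 then f (lineCount H q.1 q.2) else 0 := by
    intro z hz
    rw [Finset.mem_product] at hz
    rw [← sum_unitPairs_mul (hH.ne_zero hz.1) (hH.ne_zero hz.2)
      fun a b => if a * l + b * m = 1 then f (lineCount H a b) else 0]
    refine Finset.sum_congr rfl fun q _ => ?_
    rw [lineCount_mul_mem_eq hH hz.1 hz.2, mul_right_comm q.1, mul_right_comm q.2]
  rw [h1]
  have h3 : ∀ q ∈ unitPairs p, f (lineCount H q.1 q.2) * lineCount H (q.1 * l) (q.2 * m)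
      = ∑ z ∈ H ×ˢ H, if q.1 * l * z.1 + q.2 * m * z.2 = 1 then f (lineCount H q.1 q.2) else 0 := by
    intro q _
    rw [← Finset.sum_filter, Finset.sum_const, nsmul_eq_mul, mul_comm]
    rfl
  rw [Finset.sum_congr rfl h3, Finset.sum_comm, Finset.sum_congr rfl h2, Finset.sum_const,
    Finset.card_product, nsmul_eq_mul]
  push_cast
  ring

end Moments

/-! ### Multiplicative energy of shifted subgroups -/

section Fibers

/-- A collision count: the second moment of the fibre sizes of a map. -/
theorem sum_sq_card_fiber {α β : Type*} [DecidableEq α] [DecidableEq β] (s : Finset α)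
    (t : Finset β) (f : α → β) (h : ∀ a ∈ s, f a ∈ t) :
    ∑ b ∈ t, (s.filter fun a => f a = b).card ^ 2
      = ((s ×ˢ s).filter fun q => f q.1 = f q.2).card := by
  have hmaps : ∀ q ∈ (s ×ˢ s).filter (fun q => f q.1 = f q.2), f q.1 ∈ t := by
    intro q hq
    exact h _ (Finset.mem_product.1 (Finset.mem_filter.1 hq).1).1
  rw [Finset.card_eq_sum_card_fiberwise hmaps]
  refine Finset.sum_congr rfl fun b _ => ?_
  rw [sq, ← Finset.card_product]
  congr 1
  ext q
  simp only [Finset.mem_product, Finset.mem_filter]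
  constructor
  · rintro ⟨⟨h1, h2⟩, h3, h4⟩
    exact ⟨⟨⟨h1, h3⟩, h2.trans h4.symm⟩, h2⟩
  · rintro ⟨⟨⟨h1, h3⟩, h2⟩, h4⟩
    exact ⟨⟨h1, h4⟩, h3, h2 ▸ h4⟩

theorem sum_sq_sub_mean {ι : Type*} (s : Finset ι) (c : ι → ℝ) (d : ℝ) :
    ∑ i ∈ s, (c i - d) ^ 2
      = ∑ i ∈ s, c i ^ 2 - 2 * d * ∑ i ∈ s, c i + s.card * d ^ 2 := by
  rw [Finset.mul_sum, ← nsmul_eq_mul, ← Finset.sum_const, ← Finset.sum_sub_distrib,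
    ← Finset.sum_add_distrib]
  exact Finset.sum_congr rfl fun i _ => by ring

/-- Two functions with equal first and second moments have equal variance; it is minimal at the
mean, and each zero of the second function contributes the square of the mean. -/
theorem card_zeros_mul_sq_mean_le {ι : Type*} (s : Finset ι) (hs : s.Nonempty) (c c' : ι → ℝ)
    (h1 : ∑ i ∈ s, c i = ∑ i ∈ s, c' i) (h2 : ∑ i ∈ s, c i ^ 2 = ∑ i ∈ s, c' i ^ 2) (d : ℝ) :
    ((s.filter fun i => c' i = 0).card : ℝ) * ((∑ i ∈ s, c' i) / s.card) ^ 2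
      ≤ ∑ i ∈ s, (c i - d) ^ 2 := by
  set μ := (∑ i ∈ s, c' i) / s.card with hμ
  have hcard : (0 : ℝ) < s.card := by exact_mod_cast hs.card_pos
  have hsum : ∑ i ∈ s, c' i = s.card * μ := by
    rw [hμ]
    field_simp
  have h3 : ∑ i ∈ s, (c' i - μ) ^ 2 ≤ ∑ i ∈ s, (c i - d) ^ 2 := by
    rw [sum_sq_sub_mean, sum_sq_sub_mean, h1, h2, hsum]
    nlinarith [mul_nonneg hcard.le (sq_nonneg (μ - d))]
  refine le_trans ?_ h3
  rw [← nsmul_eq_mul, ← Finset.sum_const, Finset.sum_filter]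
  refine Finset.sum_le_sum fun i _ => ?_
  split_ifs with h
  · rw [h]; simp
  · positivity

end Fibers

section Shifted

variable {p : ℕ} {H : Finset (ZMod p)}

/-- The pairs `(u, v)` in `H × H` with `u ≠ l` and `v ≠ m`. -/
def shiftedPairs (H : Finset (ZMod p)) (l m : ZMod p) : Finset (ZMod p × ZMod p) :=
  H.erase l ×ˢ H.erase m

theorem mem_shiftedPairs {l m : ZMod p} {q : ZMod p × ZMod p} :
    q ∈ shiftedPairs H l m ↔ (q.1 ≠ l ∧ q.1 ∈ H) ∧ (q.2 ≠ m ∧ q.2 ∈ H) := by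
  simp [shiftedPairs]

theorem card_shiftedPairs_le (l m : ZMod p) : (shiftedPairs H l m).card ≤ H.card ^ 2 := by
  rw [shiftedPairs, Finset.card_product, sq]
  exact Nat.mul_le_mul Finset.card_erase_le Finset.card_erase_le

theorem le_card_shiftedPairs (l m : ZMod p) : (H.card - 1) ^ 2 ≤ (shiftedPairs H l m).card := by
  rw [shiftedPairs, Finset.card_product, sq]
  exact Nat.mul_le_mul Finset.pred_card_le_card_erase Finset.pred_card_le_card_erase

theorem sq_div_four_le_card_shiftedPairs (hn : 2 ≤ H.card) (l m : ZMod p) :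
    (H.card : ℝ) ^ 2 / 4 ≤ (shiftedPairs H l m).card := by
  have h1 : (H.card : ℝ) ^ 2 ≤ 4 * ((H.card - 1 : ℕ) : ℝ) ^ 2 := by
    have h2 : H.card ^ 2 ≤ (2 * (H.card - 1)) ^ 2 := Nat.pow_le_pow_left (by omega) 2
    have h3 : H.card ^ 2 ≤ 4 * (H.card - 1) ^ 2 := by rw [mul_pow] at h2; exact h2
    exact_mod_cast h3
  have h4 : ((H.card - 1 : ℕ) : ℝ) ^ 2 ≤ (shiftedPairs H l m).card := by
    exact_mod_cast le_card_shiftedPairs l m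
  linarith

variable [Fact p.Prime]

/-- The number of representations `t = (u - l) / (v - m)`. -/
def ratioCount (H : Finset (ZMod p)) (l m t : ZMod p) : ℕ :=
  ((shiftedPairs H l m).filter fun q => (q.1 - l) / (q.2 - m) = t).card

/-- The number of representations `t = (u - l) (v - m)`. -/
def prodCount (H : Finset (ZMod p)) (l m t : ZMod p) : ℕ :=
  ((shiftedPairs H l m).filter fun q => (q.1 - l) * (q.2 - m) = t).card

theorem div_mem_of_mem_shiftedPairs {l m : ZMod p} {q : ZMod p × ZMod p}
    (hq : q ∈ shiftedPairs H l m) : (q.1 - l) / (q.2 - m) ∈ Finset.univ.erase (0 : ZMod p) := by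
  rw [mem_shiftedPairs] at hq
  simpa using ⟨sub_ne_zero.2 hq.1.1, sub_ne_zero.2 hq.2.1⟩

theorem mul_mem_of_mem_shiftedPairs {l m : ZMod p} {q : ZMod p × ZMod p}
    (hq : q ∈ shiftedPairs H l m) : (q.1 - l) * (q.2 - m) ∈ Finset.univ.erase (0 : ZMod p) := by
  rw [mem_shiftedPairs] at hq
  simpa using ⟨sub_ne_zero.2 hq.1.1, sub_ne_zero.2 hq.2.1⟩

theorem sum_ratioCount (l m : ZMod p) :
    ∑ t ∈ Finset.univ.erase 0, ratioCount H l m t = (shiftedPairs H l m).card :=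
  (Finset.card_eq_sum_card_fiberwise fun _ hq => div_mem_of_mem_shiftedPairs hq).symm

theorem sum_prodCount (l m : ZMod p) :
    ∑ t ∈ Finset.univ.erase 0, prodCount H l m t = (shiftedPairs H l m).card :=
  (Finset.card_eq_sum_card_fiberwise fun _ hq => mul_mem_of_mem_shiftedPairs hq).symm

/-- Products and ratios have the same multiplicative energy: the equations
`(u - l) / (v - m) = (u' - l) / (v' - m)` and `(u - l) (v' - m) = (u' - l) (v - m)` agree up to
exchanging `v` and `v'`. -/
theorem sum_sq_prodCount (l m : ZMod p) :
    ∑ t ∈ Finset.univ.erase 0, prodCount H l m t ^ 2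
      = ∑ t ∈ Finset.univ.erase 0, ratioCount H l m t ^ 2 := by
  unfold prodCount ratioCount
  rw [sum_sq_card_fiber _ _ _ fun _ hq => mul_mem_of_mem_shiftedPairs hq,
    sum_sq_card_fiber _ _ _ fun _ hq => div_mem_of_mem_shiftedPairs hq]
  have hiff : ∀ u v u' v' : ZMod p, v ≠ m → v' ≠ m →
      ((u - l) / (v - m) = (u' - l) / (v' - m) ↔ (u - l) * (v' - m) = (u' - l) * (v - m)) :=
    fun u v u' v' hv hv' => div_eq_div_iff (sub_ne_zero.2 hv) (sub_ne_zero.2 hv')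
  refine Finset.card_nbij' (fun z => ((z.1.1, z.2.2), (z.2.1, z.1.2)))
    (fun z => ((z.1.1, z.2.2), (z.2.1, z.1.2))) ?_ ?_ (fun _ _ => rfl) fun _ _ => rfl
  · intro z hz
    simp only [Finset.coe_filter, Finset.mem_product, mem_shiftedPairs, Set.mem_ofPred_eq] at hz ⊢
    obtain ⟨⟨⟨h1, h2⟩, h3, h4⟩, h5⟩ := hz
    exact ⟨⟨⟨h1, h4⟩, h3, h2⟩, (hiff _ _ _ _ h4.1 h2.1).2 h5⟩
  · intro z hz
    simp only [Finset.coe_filter, Finset.mem_product, mem_shiftedPairs, Set.mem_ofPred_eq] at hz ⊢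
    obtain ⟨⟨⟨h1, h2⟩, h3, h4⟩, h5⟩ := hz
    exact ⟨⟨⟨h1, h4⟩, h3, h2⟩, (hiff _ _ _ _ h2.1 h4.1).1 h5⟩

theorem ratioCount_le_slopeCount (l m t : ZMod p) : ratioCount H l m t ≤ slopeCount H l m t := by
  refine Finset.card_le_card fun q hq => ?_
  simp only [Finset.mem_filter, mem_shiftedPairs] at hq
  simp only [Finset.mem_filter, Finset.mem_product]
  refine ⟨⟨hq.1.1.2, hq.1.2.2⟩, ?_⟩
  rw [← hq.2, div_mul_cancel₀ _ (sub_ne_zero.2 hq.1.2.1)]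

theorem slopeCount_le_ratioCount_add_one {l m t : ZMod p} (ht : t ≠ 0) :
    slopeCount H l m t ≤ ratioCount H l m t + 1 := by
  refine (Finset.card_le_card (t := insert (l, m)
    ((shiftedPairs H l m).filter fun q => (q.1 - l) / (q.2 - m) = t)) fun q hq => ?_).trans
    (Finset.card_insert_le _ _)
  simp only [Finset.mem_filter, Finset.mem_product] at hq
  rw [Finset.mem_insert, or_iff_not_imp_left]
  intro hne
  have h2 : q.2 ≠ m := by
    intro h
    apply hne
    refine Prod.ext ?_ h
    have := hq.2
    rw [h, sub_self, mul_zero, sub_eq_zero] at this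
    exact this
  have h1 : q.1 ≠ l := by
    intro h
    have := hq.2
    rw [h, sub_self, eq_comm, mul_eq_zero, or_iff_right ht, sub_eq_zero] at this
    exact h2 this
  simp only [Finset.mem_filter, mem_shiftedPairs]
  exact ⟨⟨⟨h1, hq.1.1⟩, h2, hq.1.2⟩, by rw [div_eq_iff (sub_ne_zero.2 h2), hq.2]⟩

/-- Passing from `ratioCount` to `slopeCount` and discarding the slope of the line through the
origin. -/
theorem sum_sq_ratioCount_sub_le (hH : IsMulSubgroup H) {l m : ZMod p} (hl : l ≠ 0) (hm : m ≠ 0) :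
    ∑ t ∈ Finset.univ.erase 0, ((ratioCount H l m t : ℝ) - (H.card : ℝ) ^ 2 / p) ^ 2
      ≤ 2 * (∑ t ∈ (Finset.univ.erase 0).erase (l / m),
        ((slopeCount H l m t : ℝ) - (H.card : ℝ) ^ 2 / p) ^ 2) + 2 * (H.card : ℝ) ^ 2 + 2 * p := by
  have hp : (0 : ℝ) < p := by exact_mod_cast (Fact.out : p.Prime).pos
  have hn : (H.card : ℝ) ≤ p := by exact_mod_cast hH.card_lt.le
  set D := (H.card : ℝ) ^ 2 / p with hD
  have hD0 : 0 ≤ D := by positivity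
  have hDn : D ≤ H.card := by
    rw [hD, div_le_iff₀ hp, sq]
    exact mul_le_mul_of_nonneg_left hn (Nat.cast_nonneg _)
  have h1 : ∑ t ∈ Finset.univ.erase 0, ((ratioCount H l m t : ℝ) - D) ^ 2
      ≤ ∑ t ∈ Finset.univ.erase 0, (2 * ((slopeCount H l m t : ℝ) - D) ^ 2 + 2) := by
    refine Finset.sum_le_sum fun t ht => ?_
    have h2 : (ratioCount H l m t : ℝ) ≤ slopeCount H l m t := by
      exact_mod_cast ratioCount_le_slopeCount l m t
    have h3 : (slopeCount H l m t : ℝ) ≤ ratioCount H l m t + 1 := by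
      exact_mod_cast slopeCount_le_ratioCount_add_one (Finset.ne_of_mem_erase ht)
    have h4 : ((slopeCount H l m t : ℝ) - ratioCount H l m t) ^ 2 ≤ 1 :=
      pow_le_one₀ (by linarith) (by linarith)
    nlinarith [sq_nonneg (((slopeCount H l m t : ℝ) - D) +
      ((slopeCount H l m t : ℝ) - ratioCount H l m t))]
  refine h1.trans ?_
  have hlm : l / m ∈ Finset.univ.erase (0 : ZMod p) := by simpa using ⟨hl, hm⟩
  rw [Finset.sum_add_distrib, ← Finset.mul_sum, ← Finset.add_sum_erase _ _ hlm, Finset.sum_const,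
    nsmul_eq_mul]
  have h5 : ((slopeCount H l m (l / m) : ℝ) - D) ^ 2 ≤ (H.card : ℝ) ^ 2 := by
    have h6 : (slopeCount H l m (l / m) : ℝ) ≤ H.card := by exact_mod_cast slopeCount_le l m _
    have h7 : (0 : ℝ) ≤ slopeCount H l m (l / m) := Nat.cast_nonneg _
    exact sq_le_sq' (by linarith) (by linarith)
  have h8 : ((Finset.univ.erase (0 : ZMod p)).card : ℝ) ≤ p := by
    have : (Finset.univ.erase (0 : ZMod p)).card ≤ p := by
      simp [ZMod.card]
    exact_mod_cast this
  linarith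

/-- Variance bound for large subgroups: the weights are bounded by square root cancellation. -/
theorem variance_le_of_sqrt (hH : IsMulSubgroup H) {l m : ZMod p} (hl : l ≠ 0) (hm : m ≠ 0) :
    ∑ t ∈ Finset.univ.erase 0, ((ratioCount H l m t : ℝ) - (H.card : ℝ) ^ 2 / p) ^ 2
      ≤ 12 * (H.card : ℝ) ^ 2 + 12 * (p * √p) := by
  have hp : (1 : ℝ) ≤ p := by exact_mod_cast (Fact.out : p.Prime).one_le
  have hn : (0 : ℝ) < H.card := by exact_mod_cast hH.card_pos
  refine (sum_sq_ratioCount_sub_le hH hl hm).trans ?_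
  have h1 := sum_slopeCount_eq hH (l := l) hm fun N => ((N : ℝ) - (H.card : ℝ) ^ 2 / p) ^ 2
  have h2 : ∑ q ∈ unitPairs p, ((lineCount H q.1 q.2 : ℝ) - (H.card : ℝ) ^ 2 / p) ^ 2
      * lineCount H (q.1 * l) (q.2 * m)
      ≤ (H.card : ℝ) ^ 2 * (5 * (H.card : ℝ) ^ 2 + 5 * (p * √p)) := by
    calc _ ≤ ∑ q ∈ unitPairs p, ((lineCount H q.1 q.2 : ℝ) - (H.card : ℝ) ^ 2 / p) ^ 2
          * ((H.card : ℝ) ^ 2 / p + √p) := by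
          refine Finset.sum_le_sum fun q hq => mul_le_mul_of_nonneg_left ?_ (sq_nonneg _)
          rw [mem_unitPairs] at hq
          exact lineCount_le_add_sqrt hH (mul_ne_zero hq.1 hl) (mul_ne_zero hq.2 hm)
      _ ≤ (5 * (H.card : ℝ) ^ 2 * p) * ((H.card : ℝ) ^ 2 / p + √p) := by
          rw [← Finset.sum_mul]
          exact mul_le_mul_of_nonneg_right (sum_sq_lineCount_sub_le hH) (by positivity)
      _ = _ := by field_simp
  rw [← h1] at h2
  have h3 := le_of_mul_le_mul_left h2 (by positivity)
  have h4 : (p : ℝ) ≤ p * √p := le_mul_of_one_le_right (by linarith) (Real.one_le_sqrt.2 hp)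
  linarith

/-- Dilating the coefficients by `l` and `m` permutes the lines. -/
theorem sum_rich_shifted_eq {l m : ZMod p} (hl : l ≠ 0) (hm : m ≠ 0) (K : ℕ) :
    ∑ q ∈ unitPairs p, (if K ≤ lineCount H (q.1 * l) (q.2 * m) then
      (lineCount H (q.1 * l) (q.2 * m) : ℝ) ^ 3 else 0)
    = ∑ q ∈ unitPairs p, (if K ≤ lineCount H q.1 q.2 then (lineCount H q.1 q.2 : ℝ) ^ 3 else 0) :=
  sum_unitPairs_mul hl hm fun a b =>
    if K ≤ lineCount H a b then (lineCount H a b : ℝ) ^ 3 else 0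

theorem sum_rich_le (hH : IsMulSubgroup H) {K : ℕ} (hnp : H.card ^ 3 ≤ p ^ 2) (hK : 2 ^ 31 ≤ K)
    (hKp : 2 ^ 31 * H.card ^ 2 ≤ K * p) :
    ∑ q ∈ unitPairs p, (if K ≤ lineCount H q.1 q.2 then (lineCount H q.1 q.2 : ℝ) ^ 3 else 0)
      ≤ (H.card : ℝ) ^ 2 * (2 ^ 30 * (H.card : ℝ) ^ 2 * (Nat.log 2 H.card + 1)) := by
  rw [← Finset.sum_filter]
  exact_mod_cast sum_rich_lineCount_pow_three_le hH hnp hK hKp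

/-- Variance bound for subgroups of size at most `p ^ (2 / 3)`: lines with fewer than `K` points
are controlled by the second moment over all lines, the others by the third moment. -/
theorem variance_le_of_stepanov (hH : IsMulSubgroup H) {l m : ZMod p} (hl : l ≠ 0) (hm : m ≠ 0)
    {K : ℕ} (hnp : H.card ^ 3 ≤ p ^ 2) (hK : 2 ^ 31 ≤ K) (hKp : 2 ^ 31 * H.card ^ 2 ≤ K * p) :
    ∑ t ∈ Finset.univ.erase 0, ((ratioCount H l m t : ℝ) - (H.card : ℝ) ^ 2 / p) ^ 2
      ≤ 12 * (K * p) + 2 ^ 32 * (H.card : ℝ) ^ 2 * (Nat.log 2 H.card + 1)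
        + 2 * (H.card : ℝ) ^ 2 := by
  have hp : (1 : ℝ) ≤ p := by exact_mod_cast (Fact.out : p.Prime).one_le
  have hn : (0 : ℝ) < H.card := by exact_mod_cast hH.card_pos
  refine (sum_sq_ratioCount_sub_le hH hl hm).trans ?_
  set D := (H.card : ℝ) ^ 2 / p with hD
  have hD0 : 0 ≤ D := by positivity
  have hDK : D ≤ K := by
    rw [hD, div_le_iff₀ (by linarith)]
    have : H.card ^ 2 ≤ K * p := by omega
    exact_mod_cast this
  have h1 := sum_slopeCount_eq hH (l := l) hm fun N => ((N : ℝ) - D) ^ 2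
  -- If `K ≤ M'`, the left-hand side is at most `max M M' ^ 3`, since `0 ≤ D ≤ K`.
  have hpt : ∀ M M' : ℕ, ((M : ℝ) - D) ^ 2 * M' ≤ K * ((M : ℝ) - D) ^ 2
      + (if K ≤ M then (M : ℝ) ^ 3 else 0) + (if K ≤ M' then (M' : ℝ) ^ 3 else 0) := by
    intro M M'
    have hM : (0 : ℝ) ≤ M := Nat.cast_nonneg _
    have hM' : (0 : ℝ) ≤ M' := Nat.cast_nonneg _
    have hKr : (0 : ℝ) ≤ K := Nat.cast_nonneg _
    have hsq := sq_nonneg ((M : ℝ) - D)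
    have hA : 0 ≤ (if K ≤ M then (M : ℝ) ^ 3 else 0) := by split_ifs <;> positivity
    by_cases h : K ≤ M'
    · have hKM : (K : ℝ) ≤ M' := by exact_mod_cast h
      rw [if_pos h]
      have hKs : 0 ≤ K * ((M : ℝ) - D) ^ 2 := mul_nonneg hKr hsq
      rcases le_total M M' with hle | hle
      · have hMM : (M : ℝ) ≤ M' := by exact_mod_cast hle
        have h2 : ((M : ℝ) - D) ^ 2 ≤ M' ^ 2 := by
          rw [sq_le_sq, abs_of_nonneg hM', abs_le]
          constructor <;> linarith
        have h3 : ((M : ℝ) - D) ^ 2 * M' ≤ M' ^ 2 * M' := mul_le_mul_of_nonneg_right h2 hM'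
        nlinarith
      · have hMM : (M' : ℝ) ≤ M := by exact_mod_cast hle
        have h2 : ((M : ℝ) - D) ^ 2 ≤ M ^ 2 := by
          rw [sq_le_sq, abs_of_nonneg hM, abs_le]
          constructor <;> linarith
        rw [if_pos (h.trans hle)]
        have h3 : ((M : ℝ) - D) ^ 2 * M' ≤ M ^ 2 * M := mul_le_mul h2 hMM hM' (sq_nonneg _)
        have h4 : (0 : ℝ) ≤ M' ^ 3 := by positivity
        nlinarith
    · have hKM : (M' : ℝ) ≤ K := by exact_mod_cast (not_le.1 h).le
      rw [if_neg h, mul_comm]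
      have h3 := mul_le_mul_of_nonneg_right hKM hsq
      linarith
  have h2 := Finset.sum_le_sum (s := unitPairs p) fun q _ =>
    hpt (lineCount H q.1 q.2) (lineCount H (q.1 * l) (q.2 * m))
  rw [← h1, Finset.sum_add_distrib, Finset.sum_add_distrib, sum_rich_shifted_eq hl hm,
    ← Finset.mul_sum] at h2
  have h3 := sum_rich_le hH hnp hK hKp
  have h4 : (K : ℝ) * ∑ q ∈ unitPairs p, ((lineCount H q.1 q.2 : ℝ) - D) ^ 2
      ≤ K * (5 * (H.card : ℝ) ^ 2 * p) :=
    mul_le_mul_of_nonneg_left (sum_sq_lineCount_sub_le hH) (Nat.cast_nonneg _)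
  have h5 : (H.card : ℝ) ^ 2 * ∑ t ∈ (Finset.univ.erase 0).erase (l / m),
      ((slopeCount H l m t : ℝ) - D) ^ 2 ≤ (H.card : ℝ) ^ 2 *
      (5 * (K * p) + 2 ^ 31 * (H.card : ℝ) ^ 2 * (Nat.log 2 H.card + 1)) := by
    linarith
  have h6 := le_of_mul_le_mul_left h5 (by positivity)
  have h7 : (p : ℝ) ≤ K * p := by
    have : 1 ≤ K := by omega
    exact le_mul_of_one_le_left (by linarith) (by exact_mod_cast this)
  linarith

/-- Bound for the second moment (the multiplicative energy of the shifts `H - l`, `H - m`). -/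
theorem sum_sq_ratioCount_le (hH : IsMulSubgroup H) {l m : ZMod p} (hl : l ≠ 0) (hm : m ≠ 0)
    {K : ℕ} (hnp : H.card ^ 3 ≤ p ^ 2) (hK : 2 ^ 31 ≤ K) (hKp : 2 ^ 31 * H.card ^ 2 ≤ K * p) :
    ∑ t ∈ Finset.univ.erase 0, (ratioCount H l m t : ℝ) ^ 2
      ≤ (K + 1) * (H.card : ℝ) ^ 2 + 2 ^ 31 * (H.card : ℝ) ^ 2 * (Nat.log 2 H.card + 1) := by
  have hn : (0 : ℝ) < H.card := by exact_mod_cast hH.card_pos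
  have hlm : l / m ∈ Finset.univ.erase (0 : ZMod p) := by simpa using ⟨hl, hm⟩
  set f : ℕ → ℝ := fun N => if K ≤ N then (N : ℝ) ^ 2 else 0 with hf
  have h1 := sum_slopeCount_eq hH (l := l) hm f
  have hpt : ∀ M M' : ℕ, f M * M' ≤ (if K ≤ M then (M : ℝ) ^ 3 else 0)
      + (if K ≤ M' then (M' : ℝ) ^ 3 else 0) := by
    intro M M'
    have hM : (0 : ℝ) ≤ M := Nat.cast_nonneg _
    have hM' : (0 : ℝ) ≤ M' := Nat.cast_nonneg _
    by_cases h : K ≤ M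
    · simp only [hf, if_pos h]
      rcases le_total M M' with hle | hle
      · have hMM : (M : ℝ) ≤ M' := by exact_mod_cast hle
        rw [if_pos (h.trans hle)]
        have h2 : (M : ℝ) ^ 2 * M' ≤ M' ^ 2 * M' :=
          mul_le_mul_of_nonneg_right (pow_le_pow_left₀ hM hMM 2) hM'
        have h3 : (0 : ℝ) ≤ M ^ 3 := by positivity
        nlinarith
      · have hMM : (M' : ℝ) ≤ M := by exact_mod_cast hle
        have h2 : (M : ℝ) ^ 2 * M' ≤ M ^ 2 * M := mul_le_mul_of_nonneg_left hMM (sq_nonneg _)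
        have h3 : 0 ≤ (if K ≤ M' then (M' : ℝ) ^ 3 else 0) := by split_ifs <;> positivity
        nlinarith
    · simp only [hf, if_neg h, zero_mul]
      split_ifs <;> positivity
  have h2 := Finset.sum_le_sum (s := unitPairs p) fun q _ =>
    hpt (lineCount H q.1 q.2) (lineCount H (q.1 * l) (q.2 * m))
  rw [← h1, Finset.sum_add_distrib, sum_rich_shifted_eq hl hm] at h2
  have h3 := sum_rich_le hH hnp hK hKp
  have h4 : (H.card : ℝ) ^ 2 * ∑ t ∈ (Finset.univ.erase 0).erase (l / m), f (slopeCount H l m t)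
      ≤ (H.card : ℝ) ^ 2 * (2 ^ 31 * (H.card : ℝ) ^ 2 * (Nat.log 2 H.card + 1)) := by
    linarith
  have h5 := le_of_mul_le_mul_left h4 (by positivity)
  have h6 : ∑ t ∈ (Finset.univ.erase 0).erase (l / m), (ratioCount H l m t : ℝ) ^ 2
      ≤ ∑ t ∈ (Finset.univ.erase 0).erase (l / m),
        (K * (ratioCount H l m t : ℝ) + f (slopeCount H l m t)) := by
    refine Finset.sum_le_sum fun t _ => ?_
    have hR : (0 : ℝ) ≤ ratioCount H l m t := Nat.cast_nonneg _
    have h7 : (ratioCount H l m t : ℝ) ≤ slopeCount H l m t := by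
      exact_mod_cast ratioCount_le_slopeCount l m t
    by_cases h : K ≤ slopeCount H l m t
    · simp only [hf, if_pos h]
      have := pow_le_pow_left₀ hR h7 2
      have hKR : (0 : ℝ) ≤ K * (ratioCount H l m t : ℝ) := by positivity
      linarith
    · simp only [hf, if_neg h, add_zero]
      rw [sq]
      refine mul_le_mul_of_nonneg_right (h7.trans ?_) hR
      exact_mod_cast (not_le.1 h).le
  rw [Finset.sum_add_distrib, ← Finset.mul_sum] at h6
  have h8 : ∑ t ∈ (Finset.univ.erase 0).erase (l / m), (ratioCount H l m t : ℝ)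
      ≤ (H.card : ℝ) ^ 2 := by
    have h9 : ∑ t ∈ (Finset.univ.erase 0).erase (l / m), ratioCount H l m t ≤ H.card ^ 2 := by
      refine (Finset.sum_le_sum_of_subset (Finset.erase_subset _ _)).trans ?_
      rw [sum_ratioCount]
      exact card_shiftedPairs_le l m
    exact_mod_cast h9
  have h10 : (ratioCount H l m (l / m) : ℝ) ^ 2 ≤ (H.card : ℝ) ^ 2 := by
    refine pow_le_pow_left₀ (Nat.cast_nonneg _) ?_ 2
    exact_mod_cast (ratioCount_le_slopeCount l m _).trans (slopeCount_le l m _)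
  have h11 := mul_le_mul_of_nonneg_left h8 (Nat.cast_nonneg (α := ℝ) K)
  rw [← Finset.add_sum_erase _ _ hlm]
  linarith

end Shifted

/-! ### From moments to the size of the value sets -/

section Counting

variable {p : ℕ} [Fact p.Prime] {H : Finset (ZMod p)}

/-- The number of nonzero residues at which a counting function does not vanish. -/
def supportCard (c : ZMod p → ℕ) : ℕ := ((Finset.univ.erase 0).filter fun t => ¬ c t = 0).card

theorem card_zeros_add_supportCard (c : ZMod p → ℕ) :
    ((Finset.univ.erase 0).filter fun t => c t = 0).card + supportCard c + 1 = p := by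
  have h := Finset.card_filter_add_card_filter_not (s := Finset.univ.erase (0 : ZMod p))
    (fun t => c t = 0)
  rw [Finset.card_erase_of_mem (Finset.mem_univ _), Finset.card_univ, ZMod.card] at h
  have := (Fact.out : p.Prime).one_le
  unfold supportCard
  omega

theorem sq_sum_le_supportCard_mul (c : ZMod p → ℕ) :
    (∑ t ∈ Finset.univ.erase 0, (c t : ℝ)) ^ 2
      ≤ supportCard c * ∑ t ∈ Finset.univ.erase 0, (c t : ℝ) ^ 2 := by
  have h1 : ∑ t ∈ Finset.univ.erase 0, (c t : ℝ)
      = ∑ t ∈ Finset.univ.erase 0 with ¬ c t = 0, (c t : ℝ) := by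
    rw [Finset.sum_filter]
    refine Finset.sum_congr rfl fun t _ => ?_
    split_ifs with h
    · simp [h]
    · rfl
  rw [h1]
  refine (sq_sum_le_card_mul_sum_sq).trans ?_
  refine mul_le_mul_of_nonneg_left ?_ (Nat.cast_nonneg _)
  exact Finset.sum_le_sum_of_subset_of_nonneg (Finset.filter_subset _ _)
    fun _ _ _ => by positivity

/-- `c` counts the representations of a residue as a ratio, or as a product, of elements of `H - l`
and `H - m`. -/
def IsShiftCount (H : Finset (ZMod p)) (l m : ZMod p) (c : ZMod p → ℕ) : Prop :=
  c = ratioCount H l m ∨ c = prodCount H l m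

theorem IsShiftCount.sum_eq {l m : ZMod p} {c : ZMod p → ℕ} (hc : IsShiftCount H l m c) :
    ∑ t ∈ Finset.univ.erase 0, (c t : ℝ) = (shiftedPairs H l m).card := by
  rcases hc with rfl | rfl
  · exact_mod_cast sum_ratioCount l m
  · exact_mod_cast sum_prodCount l m

theorem IsShiftCount.sum_sq_eq {l m : ZMod p} {c : ZMod p → ℕ} (hc : IsShiftCount H l m c) :
    ∑ t ∈ Finset.univ.erase 0, (c t : ℝ) ^ 2
      = ∑ t ∈ Finset.univ.erase 0, (ratioCount H l m t : ℝ) ^ 2 := by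
  rcases hc with rfl | rfl
  · rfl
  · exact_mod_cast sum_sq_prodCount l m

/-- A variance bound for the ratios controls the missing values of both counting functions. -/
theorem IsShiftCount.sub_supportCard_le {l m : ZMod p} {c : ZMod p → ℕ}
    (hc : IsShiftCount H l m c) (hn : 2 ≤ H.card) {V : ℝ}
    (hV : ∑ t ∈ Finset.univ.erase 0, ((ratioCount H l m t : ℝ) - (H.card : ℝ) ^ 2 / p) ^ 2 ≤ V) :
    (p : ℝ) - supportCard c ≤ 1 + 16 * (p : ℝ) ^ 2 * V / (H.card : ℝ) ^ 4 := by
  have hp2 : 2 ≤ p := (Fact.out : p.Prime).two_le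
  have hcard : (Finset.univ.erase (0 : ZMod p)).card = p - 1 := by
    rw [Finset.card_erase_of_mem (Finset.mem_univ _), Finset.card_univ, ZMod.card]
  have hne : (Finset.univ.erase (0 : ZMod p)).Nonempty := Finset.card_pos.1 (by omega)
  have hr : IsShiftCount H l m (ratioCount H l m) := Or.inl rfl
  have h1 := (card_zeros_mul_sq_mean_le _ hne (fun t => (ratioCount H l m t : ℝ))
    (fun t => (c t : ℝ)) (hr.sum_eq.trans hc.sum_eq.symm) hc.sum_sq_eq.symm _).trans hV
  simp only [Nat.cast_eq_zero] at h1
  rw [hc.sum_eq, hcard] at h1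
  have h2 := card_zeros_add_supportCard c
  rw [← Nat.cast_inj (R := ℝ)] at h2
  push_cast at h2
  set Z : ℝ := (((Finset.univ.erase 0).filter fun t => c t = 0).card : ℝ) with hZ
  have hZ0 : 0 ≤ Z := Nat.cast_nonneg _
  have hn' : (0 : ℝ) < H.card := by exact_mod_cast (show 0 < H.card by omega)
  have hp1 : (0 : ℝ) < ((p - 1 : ℕ) : ℝ) := by exact_mod_cast (show 0 < p - 1 by omega)
  have hpp : ((p - 1 : ℕ) : ℝ) ≤ p := by exact_mod_cast Nat.sub_le p 1
  have h3 : (H.card : ℝ) ^ 2 / 4 / p ≤ (shiftedPairs H l m).card / ((p - 1 : ℕ) : ℝ) :=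
    div_le_div₀ (Nat.cast_nonneg _) (sq_div_four_le_card_shiftedPairs hn l m) hp1 hpp
  have h4 : Z * ((H.card : ℝ) ^ 2 / 4 / p) ^ 2 ≤ V :=
    (mul_le_mul_of_nonneg_left (pow_le_pow_left₀ (by positivity) h3 2) hZ0).trans h1
  have hp0 : (0 : ℝ) < p := by exact_mod_cast (show 0 < p by omega)
  have h5 : Z ≤ 16 * (p : ℝ) ^ 2 * V / (H.card : ℝ) ^ 4 := by
    rw [le_div_iff₀ (by positivity)]
    have h6 : Z * (H.card : ℝ) ^ 4
        = 16 * (p : ℝ) ^ 2 * (Z * ((H.card : ℝ) ^ 2 / 4 / p) ^ 2) := by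
      field_simp
      ring
    rw [h6]
    exact mul_le_mul_of_nonneg_left h4 (by positivity)
  linarith

theorem one_le_log_of_two_le_card (hH : IsMulSubgroup H) (hn : 2 ≤ H.card) :
    1 ≤ Real.log p := by
  have h1 := hH.card_lt
  have hp : (3 : ℝ) ≤ p := by exact_mod_cast (show 3 ≤ p by omega)
  rw [Real.le_log_iff_exp_le (by linarith)]
  have := Real.exp_one_lt_d9
  linarith

theorem natLog_two_le (n : ℕ) (hn : 0 < n) : (Nat.log 2 n : ℝ) ≤ 3 / 2 * Real.log n := by
  have h1 : (2 : ℝ) ^ Nat.log 2 n ≤ n := by exact_mod_cast Nat.pow_log_le_self 2 hn.ne'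
  have h2 := Real.log_le_log (by positivity) h1
  rw [Real.log_pow] at h2
  have h3 := Real.log_two_gt_d9
  have h4 : (0 : ℝ) ≤ Nat.log 2 n := Nat.cast_nonneg _
  nlinarith

/-- The threshold `2 ^ 31 * (n ^ 2 / p + 1)` satisfies the conditions of the Stepanov bound. -/
theorem exists_threshold (p n : ℕ) (hp : 0 < p) : ∃ K : ℕ, 2 ^ 31 ≤ K ∧
    2 ^ 31 * n ^ 2 ≤ K * p ∧ (K : ℝ) ≤ 2 ^ 31 * ((n : ℝ) ^ 2 / p + 1) := by
  refine ⟨2 ^ 31 * (n ^ 2 / p + 1), Nat.le_mul_of_pos_right _ (Nat.succ_pos _), ?_, ?_⟩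
  · have := Nat.lt_mul_div_succ (n ^ 2) hp
    nlinarith
  · have h : ((n ^ 2 / p : ℕ) : ℝ) ≤ (n : ℝ) ^ 2 / p := by
      exact_mod_cast Nat.cast_div_le (α := ℝ) (m := n ^ 2) (n := p)
    push_cast
    linarith

/-- For `n ^ 3 ≥ p ^ 2` the term `p ^ (3 / 2)` of `variance_le_of_sqrt` is still absorbed when
`n ≤ p ^ (1 / 2) * L`. -/
theorem mul_sqrt_le_of_sq_le {n p L : ℝ} (hn : 0 < n) (hp : 0 < p) (hL : 0 ≤ L)
    (h1 : p ^ 2 ≤ n ^ 3) (h2 : n ^ 2 ≤ p * L ^ 2) : p * √p ≤ n ^ 2 * L := by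
  refine le_of_sq_le_sq ?_ (by positivity)
  rw [mul_pow, Real.sq_sqrt hp.le]
  have h3 : p ^ 4 ≤ n ^ 6 := by
    calc p ^ 4 = (p ^ 2) ^ 2 := by ring
      _ ≤ (n ^ 3) ^ 2 := pow_le_pow_left₀ (by positivity) h1 2
      _ = n ^ 6 := by ring
  have h4 : n ^ 4 * n ^ 2 ≤ n ^ 4 * (p * L ^ 2) := mul_le_mul_of_nonneg_left h2 (by positivity)
  have h5 : p * (p ^ 2 * p) ≤ p * ((n ^ 2 * L) ^ 2) := by nlinarith
  exact le_of_mul_le_mul_left h5 hp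

/-- Variance bound for subgroups of size at least `p ^ (1 / 2)`; the second alternative in `h`
only matters for bounded `p`. -/
theorem variance_le_log (hH : IsMulSubgroup H) {l m : ZMod p} (hl : l ≠ 0) (hm : m ≠ 0)
    (hn : 2 ≤ H.card) (hnp : (p : ℝ) ≤ (H.card : ℝ) ^ 2)
    (h : H.card ^ 3 ≤ p ^ 2 ∨ (H.card : ℝ) ^ 2 ≤ p * Real.log p ^ 2) :
    ∑ t ∈ Finset.univ.erase 0, ((ratioCount H l m t : ℝ) - (H.card : ℝ) ^ 2 / p) ^ 2
      ≤ 2 ^ 36 * ((H.card : ℝ) ^ 2 * Real.log p) := by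
  have hL := one_le_log_of_two_le_card hH hn
  have hp0 : (0 : ℝ) < p := by exact_mod_cast (Fact.out : p.Prime).pos
  have hn0 : (0 : ℝ) < H.card := by exact_mod_cast hH.card_pos
  have hnL : (H.card : ℝ) ^ 2 ≤ (H.card : ℝ) ^ 2 * Real.log p :=
    le_mul_of_one_le_right (by positivity) hL
  by_cases h3 : H.card ^ 3 ≤ p ^ 2
  · obtain ⟨K, hK, hKp, hKle⟩ := exists_threshold p H.card (Fact.out : p.Prime).pos
    refine (variance_le_of_stepanov hH hl hm h3 hK hKp).trans ?_
    have h4 : (K : ℝ) * p ≤ 2 ^ 32 * (H.card : ℝ) ^ 2 := by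
      have h5 := mul_le_mul_of_nonneg_right hKle hp0.le
      have h6 : 2 ^ 31 * ((H.card : ℝ) ^ 2 / p + 1) * p = 2 ^ 31 * ((H.card : ℝ) ^ 2 + p) := by
        field_simp
      linarith
    have h7 : (Nat.log 2 H.card : ℝ) + 1 ≤ 5 / 2 * Real.log p := by
      have h8 := natLog_two_le H.card hH.card_pos
      have h9 : Real.log H.card ≤ Real.log p :=
        Real.log_le_log hn0 (by exact_mod_cast hH.card_lt.le)
      linarith
    have h10 : 2 ^ 32 * (H.card : ℝ) ^ 2 * ((Nat.log 2 H.card : ℝ) + 1)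
        ≤ 2 ^ 32 * (H.card : ℝ) ^ 2 * (5 / 2 * Real.log p) :=
      mul_le_mul_of_nonneg_left h7 (by positivity)
    linarith
  · have h4 := h.resolve_left h3
    refine (variance_le_of_sqrt hH hl hm).trans ?_
    have h5 : (p : ℝ) ^ 2 ≤ (H.card : ℝ) ^ 3 := by exact_mod_cast (not_le.1 h3).le
    have h6 := mul_sqrt_le_of_sq_le hn0 hp0 (by linarith) h5 h4
    linarith

/-- The multiplicative energy of two shifts of a small subgroup. -/
theorem sum_sq_ratioCount_le_log (hH : IsMulSubgroup H) {l m : ZMod p} (hl : l ≠ 0) (hm : m ≠ 0)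
    (hn : 2 ≤ H.card) (h : (H.card : ℝ) ^ 2 ≤ p * Real.log p) :
    ∑ t ∈ Finset.univ.erase 0, (ratioCount H l m t : ℝ) ^ 2
      ≤ 2 ^ 38 * ((H.card : ℝ) ^ 2 * Real.log H.card) := by
  have hL := one_le_log_of_two_le_card hH hn
  have hp0 : (0 : ℝ) < p := by exact_mod_cast (Fact.out : p.Prime).pos
  have hn0 : (0 : ℝ) < H.card := by exact_mod_cast hH.card_pos
  have hn2 : (2 : ℝ) ≤ H.card := by exact_mod_cast hn
  have hlog : 2 / 3 ≤ Real.log H.card := by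
    have h1 := Real.log_le_log (by norm_num) hn2
    have h2 := Real.log_two_gt_d9
    linarith
  have hD : (H.card : ℝ) ^ 2 / p ≤ Real.log p := by
    rw [div_le_iff₀ hp0]
    linarith
  by_cases hnp : (p : ℝ) ≤ (H.card : ℝ) ^ 2
  · have hlogp : Real.log p ≤ 2 * Real.log H.card := by
      have := Real.log_le_log hp0 hnp
      rwa [Real.log_pow] at this
    have hV := variance_le_log hH hl hm hn hnp (Or.inr (by nlinarith))
    rw [sum_sq_sub_mean, (show IsShiftCount H l m (ratioCount H l m) from Or.inl rfl).sum_eq] at hV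
    have h1 : ((shiftedPairs H l m).card : ℝ) ≤ (H.card : ℝ) ^ 2 := by
      exact_mod_cast card_shiftedPairs_le l m
    have h2 : (H.card : ℝ) ^ 2 / p * ((shiftedPairs H l m).card : ℝ)
        ≤ Real.log p * (H.card : ℝ) ^ 2 := mul_le_mul hD h1 (Nat.cast_nonneg _) (by linarith)
    have h3 : (0 : ℝ) ≤ ((Finset.univ.erase (0 : ZMod p)).card : ℝ)
        * ((H.card : ℝ) ^ 2 / p) ^ 2 := by positivity
    have h4 : (H.card : ℝ) ^ 2 * Real.log p ≤ (H.card : ℝ) ^ 2 * (2 * Real.log H.card) :=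
      mul_le_mul_of_nonneg_left hlogp (by positivity)
    have h5 : 0 ≤ (H.card : ℝ) ^ 2 * Real.log H.card := by positivity
    linarith
  · have h3 : H.card ^ 3 ≤ p ^ 2 := by
      have h4 : H.card ^ 2 ≤ p := by exact_mod_cast (not_le.1 hnp).le
      have h5 : (H.card ^ 2) ^ 2 ≤ p ^ 2 := Nat.pow_le_pow_left h4 2
      have h6 : H.card ^ 3 ≤ H.card ^ 4 := Nat.pow_le_pow_right hH.card_pos (by norm_num)
      calc H.card ^ 3 ≤ H.card ^ 4 := h6
        _ = (H.card ^ 2) ^ 2 := by ring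
        _ ≤ p ^ 2 := h5
    obtain ⟨K, hK, hKp, hKle⟩ := exists_threshold p H.card (Fact.out : p.Prime).pos
    refine (sum_sq_ratioCount_le hH hl hm h3 hK hKp).trans ?_
    have h4 : (H.card : ℝ) ^ 2 / p ≤ 1 := by
      rw [div_le_one hp0]
      exact (not_le.1 hnp).le
    have h5 : (Nat.log 2 H.card : ℝ) + 1 ≤ 3 * Real.log H.card := by
      have h8 := natLog_two_le H.card hH.card_pos
      linarith
    have h6 : (K : ℝ) + 1 + 2 ^ 31 * ((Nat.log 2 H.card : ℝ) + 1) ≤ 2 ^ 38 * Real.log H.card := by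
      linarith
    have h7 := mul_le_mul_of_nonneg_left h6 (sq_nonneg (H.card : ℝ))
    linarith

/-- Cauchy-Schwarz turns the energy bound into a lower bound for the number of values. -/
theorem IsShiftCount.le_supportCard {l m : ZMod p} {c : ZMod p → ℕ}
    (hc : IsShiftCount H l m c) (hH : IsMulSubgroup H) (hl : l ≠ 0) (hm : m ≠ 0)
    (hn : 2 ≤ H.card) (h : (H.card : ℝ) ^ 2 ≤ p * Real.log p) :
    1 / 2 ^ 42 * ((H.card : ℝ) ^ 2 / Real.log H.card) ≤ supportCard c := by
  have h1 := sq_sum_le_supportCard_mul c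
  rw [hc.sum_eq, hc.sum_sq_eq] at h1
  have h2 := sum_sq_ratioCount_le_log hH hl hm hn h
  have h3 := pow_le_pow_left₀ (by positivity) (sq_div_four_le_card_shiftedPairs hn l m) 2
  have h4 := mul_le_mul_of_nonneg_left h2 (Nat.cast_nonneg (α := ℝ) (supportCard c))
  have hn0 : (0 : ℝ) < (H.card : ℝ) ^ 2 := by
    have := hH.card_pos
    positivity
  have hlog : 0 < Real.log H.card := Real.log_pos (by exact_mod_cast hn)
  rw [mul_div_assoc', div_le_iff₀ hlog]
  have h5 : (H.card : ℝ) ^ 2 * (1 / 2 ^ 42 * (H.card : ℝ) ^ 2)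
      ≤ (H.card : ℝ) ^ 2 * (supportCard c * Real.log H.card) := by linarith
  exact le_of_mul_le_mul_left h5 hn0

theorem sq_card_lt_card_quadSolutions (hH : IsMulSubgroup H) (h : p ^ 2 ≤ H.card ^ 3)
    {a b c d : ZMod p} (ha : a ≠ 0) (hb : b ≠ 0) (hc : c ≠ 0) (hd : d ≠ 0) :
    H.card ^ 2 < (quadSolutions H a b c d).card := by
  have h1 := le_card_quadSolutions hH ha hb hc hd
  have hp0 : (0 : ℝ) < p := by exact_mod_cast (Fact.out : p.Prime).pos
  have hn0 : (0 : ℝ) < H.card := by exact_mod_cast hH.card_pos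
  have hnp : (H.card : ℝ) < p := by exact_mod_cast hH.card_lt
  have h2 : (p : ℝ) ^ 2 ≤ (H.card : ℝ) ^ 3 := by exact_mod_cast h
  set n : ℝ := (H.card : ℝ) with hn
  have h3 : n * (n * (p - n)) ≤ n * (n ^ 3 - (p - n) ^ 2 - n * p) :=
    mul_le_mul_of_nonneg_left (by linarith) hn0.le
  have h4 : 0 < n * (n * (p - n)) := mul_pos hn0 (mul_pos hn0 (by linarith))
  have h5 : (p : ℝ) * n ^ 2 < p * (quadSolutions H a b c d).card := by linarith
  have h6 := lt_of_mul_lt_mul_left h5 hp0.le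
  rw [hn] at h6
  exact_mod_cast h6

theorem exists_triple_of_large (hH : IsMulSubgroup H) (h : p ^ 2 ≤ H.card ^ 3) {l m x : ZMod p}
    (hl : l ≠ 0) (hm : m ≠ 0) (hx : x ≠ 0) :
    ∃ u ∈ H, ∃ v ∈ H, ∃ w ∈ H, x = u + l * v + m * w := by
  have h1 := sq_card_lt_card_quadSolutions hH h (one_ne_zero (α := ZMod p)) hl hm (neg_ne_zero.2 hx)
  obtain ⟨q, hq⟩ := Finset.card_pos.1 (Nat.zero_lt_of_lt h1)
  simp only [quadSolutions, Finset.mem_filter, Finset.mem_product] at hq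
  obtain ⟨⟨⟨h2, h3⟩, h4, h5⟩, h6⟩ := hq
  have h7 := hH.ne_zero h5
  have h8 := hH.inv_mem h5
  refine ⟨_, hH.mul_mem h2 h8, _, hH.mul_mem h3 h8, _, hH.mul_mem h4 h8, ?_⟩
  field_simp
  linear_combination -h6

/-- There are more than `|H| ^ 2` solutions of the homogenised equation, while at most `|H| ^ 2`
of them have a vanishing denominator. -/
theorem exists_ratio_of_large (hH : IsMulSubgroup H) (h : p ^ 2 ≤ H.card ^ 3) {l m x : ZMod p}
    (hl : l ≠ 0) (hm : m ≠ 0) (hx : x ≠ 0) :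
    ∃ g ∈ H, ∃ u ∈ H, ∃ v ∈ H, v ≠ m ∧ x = g * ((u - l) / (v - m)) := by
  have h1 := sq_card_lt_card_quadSolutions hH h hx (neg_ne_zero.2 (one_ne_zero (α := ZMod p))) hl
    (neg_ne_zero.2 (mul_ne_zero hx hm))
  obtain ⟨q, hq, hqm⟩ : ∃ q ∈ quadSolutions H x (-1) l (-(x * m)), q.1.1 ≠ m * q.2.2 := by
    by_contra hcon
    push Not at hcon
    have h2 : (quadSolutions H x (-1) l (-(x * m))).card ≤ (H ×ˢ H).card := by
      refine Finset.card_le_card_of_injOn (fun q => q.2) ?_ ?_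
      · intro q hq
        simp only [quadSolutions, Finset.coe_filter, Finset.mem_product, Set.mem_ofPred_eq] at hq
        simpa using hq.1.2
      · intro q hq r hr hqr
        have hq1 := hcon q hq
        have hr1 := hcon r hr
        simp only [quadSolutions, Finset.coe_filter, Set.mem_ofPred_eq] at hq hr hqr
        have h3 : q.1.1 = r.1.1 := by rw [hq1, hr1, hqr]
        have h4 : q.1.2 = r.1.2 := by
          have := hq.2
          rw [hqr, h3] at this
          linear_combination hr.2 - this
        exact Prod.ext (Prod.ext h3 h4) hqr
    rw [Finset.card_product, ← sq] at h2
    omega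
  simp only [quadSolutions, Finset.mem_filter, Finset.mem_product] at hq
  obtain ⟨⟨⟨hv, hy⟩, hg, hh⟩, heq⟩ := hq
  have hg0 := hH.ne_zero hg
  have hh0 := hH.ne_zero hh
  refine ⟨_, hH.mul_mem hg (hH.inv_mem hh), _, hH.mul_mem hy (hH.inv_mem hg), _,
    hH.mul_mem hv (hH.inv_mem hh), ?_, ?_⟩
  · intro h0
    apply hqm
    rw [← h0, inv_mul_cancel_right₀ hh0]
  · have h0 : q.1.1 * q.2.2⁻¹ - m ≠ 0 := by
      intro h0
      apply hqm
      rw [← sub_eq_zero.1 h0, inv_mul_cancel_right₀ hh0]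
    rw [mul_div_assoc', eq_div_iff h0]
    field_simp
    linear_combination heq

end Counting

/-! ### The triple sumset and the shifted ratio set -/

section Assembly

variable {p : ℕ} [Fact p.Prime]

/-- The elements of `G`, as a finite set of residues. -/
noncomputable def subgroupFinset (G : Subgroup (ZMod p)ˣ) : Finset (ZMod p) :=
  (Set.toFinite (subgroupSet G)).toFinset

theorem mem_subgroupFinset {G : Subgroup (ZMod p)ˣ} {x : ZMod p} :
    x ∈ subgroupFinset G ↔ x ∈ subgroupSet G := by
  simp [subgroupFinset]

theorem card_subgroupFinset (G : Subgroup (ZMod p)ˣ) : (subgroupFinset G).card = Nat.card G := by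
  have h : subgroupSet G = (fun g : (ZMod p)ˣ => (g : ZMod p)) '' (G : Set (ZMod p)ˣ) := rfl
  rw [subgroupFinset, ← Set.ncard_eq_toFinset_card, h,
    Set.ncard_image_of_injective _ Units.val_injective]
  rfl

theorem isMulSubgroup_subgroupFinset (G : Subgroup (ZMod p)ˣ) :
    IsMulSubgroup (subgroupFinset G) where
  zero_notMem h := by
    obtain ⟨g, _, hg⟩ := mem_subgroupFinset.1 h
    exact g.ne_zero hg
  one_mem := mem_subgroupFinset.2 ⟨1, G.one_mem, rfl⟩
  mul_mem hx hy := by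
    obtain ⟨g, hg, rfl⟩ := mem_subgroupFinset.1 hx
    obtain ⟨h, hh, rfl⟩ := mem_subgroupFinset.1 hy
    exact mem_subgroupFinset.2 ⟨g * h, G.mul_mem hg hh, rfl⟩
  inv_mem hx := by
    obtain ⟨g, hg, rfl⟩ := mem_subgroupFinset.1 hx
    exact mem_subgroupFinset.2 ⟨g⁻¹, G.inv_mem hg, Units.val_inv_eq_inv_val g⟩

theorem mem_tripleSumset {G : Subgroup (ZMod p)ˣ} {l m u v w : ZMod p}
    (hu : u ∈ subgroupFinset G) (hv : v ∈ subgroupFinset G) (hw : w ∈ subgroupFinset G) :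
    u + l * v + m * w ∈ tripleSumset G l m :=
  Set.add_mem_add (Set.add_mem_add (mem_subgroupFinset.1 hu)
    (Set.smul_mem_smul_set (mem_subgroupFinset.1 hv)))
    (Set.smul_mem_smul_set (mem_subgroupFinset.1 hw))

/-- `a b + l a + m b = (a + m) (b + l) - l m`, so a translate of the triple sumset contains the
products of two shifts of `G`. -/
theorem supportCard_prodCount_le_ncard (G : Subgroup (ZMod p)ˣ) (l m : ZMod p) :
    supportCard (prodCount (subgroupFinset G) (-m) (-l)) ≤ (tripleSumset G l m).ncard := by
  unfold supportCard
  rw [← Set.ncard_coe_finset]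
  refine Set.ncard_le_ncard_of_injOn (fun t => t - l * m) ?_ ?_ (Set.toFinite _)
  · intro t ht
    simp only [Finset.coe_filter, Set.mem_ofPred_eq, prodCount, Finset.card_eq_zero,
      ← Finset.nonempty_iff_ne_empty, ← ne_eq] at ht
    obtain ⟨q, hq⟩ := ht.2
    rw [Finset.mem_filter, mem_shiftedPairs] at hq
    have h := mem_tripleSumset (l := l) (m := m)
      ((isMulSubgroup_subgroupFinset G).mul_mem hq.1.1.2 hq.1.2.2) hq.1.1.2 hq.1.2.2
    convert h using 1
    rw [← hq.2]
    ring
  · exact fun _ _ _ _ h => sub_left_injective h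

theorem supportCard_ratioCount_le_ncard (G : Subgroup (ZMod p)ˣ) (l m : ZMod p) :
    supportCard (ratioCount (subgroupFinset G) l m) ≤ (shiftedRatioSet G l m).ncard := by
  unfold supportCard
  rw [← Set.ncard_coe_finset]
  refine Set.ncard_le_ncard ?_ (Set.toFinite _)
  intro t ht
  simp only [Finset.coe_filter, Set.mem_ofPred_eq, ratioCount, Finset.card_eq_zero,
    ← Finset.nonempty_iff_ne_empty, ← ne_eq] at ht
  obtain ⟨q, hq⟩ := ht.2
  rw [Finset.mem_filter, mem_shiftedPairs] at hq
  exact ⟨q.1, mem_subgroupFinset.1 hq.1.1.2, q.2, mem_subgroupFinset.1 hq.1.2.2, hq.1.2.1,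
    hq.2.symm⟩

theorem sq_le_pow_three_of_rpow_le {x n : ℝ} (hx : 0 ≤ x) (h : x ^ (2 / 3 : ℝ) ≤ n) :
    x ^ 2 ≤ n ^ 3 := by
  have h1 := pow_le_pow_left₀ (by positivity) h 3
  rw [← Real.rpow_natCast (x ^ (2 / 3 : ℝ)), ← Real.rpow_mul hx] at h1
  norm_num at h1
  exact h1

theorem pow_three_le_sq_of_le_rpow {x n : ℝ} (hx : 0 ≤ x) (hn : 0 ≤ n)
    (h : n ≤ x ^ (2 / 3 : ℝ)) : n ^ 3 ≤ x ^ 2 := by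
  have h1 := pow_le_pow_left₀ hn h 3
  rw [← Real.rpow_natCast (x ^ (2 / 3 : ℝ)), ← Real.rpow_mul hx] at h1
  norm_num at h1
  exact h1

/-- The elementary inequality behind the bound for subgroups of size at least `p ^ (2 / 3)`. -/
theorem missing_le_large {x n : ℝ} (hn : 1 ≤ n) (hnx : n ≤ x) (h : x ^ 2 ≤ n ^ 3) :
    1 + 16 * x ^ 2 * (12 * n ^ 2 + 12 * (x * √x)) / n ^ 4
      ≤ 385 * (x ^ (5 / 2 : ℝ) * n ^ (-(5 / 2) : ℝ)) := by
  obtain ⟨r, hr, rfl⟩ : ∃ r : ℝ, 0 ≤ r ∧ x = r ^ 2 :=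
    ⟨√x, Real.sqrt_nonneg _, (Real.sq_sqrt (by linarith)).symm⟩
  obtain ⟨w, hw, rfl⟩ : ∃ w : ℝ, 0 ≤ w ∧ n = w ^ 2 :=
    ⟨√n, Real.sqrt_nonneg _, (Real.sq_sqrt (by linarith)).symm⟩
  have hw0 : 0 < w := by
    rcases hw.eq_or_lt with h0 | h0
    · rw [← h0] at hn; norm_num at hn
    · exact h0
  have hwr : w ≤ r := le_of_sq_le_sq hnx hr
  have hrw : r ^ 2 ≤ w ^ 3 := by
    refine le_of_sq_le_sq ?_ (by positivity)
    calc (r ^ 2) ^ 2 ≤ (w ^ 2) ^ 3 := h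
      _ = (w ^ 3) ^ 2 := by ring
  have h1 : (r ^ 2) ^ (5 / 2 : ℝ) = r ^ 5 := by
    rw [← Real.rpow_natCast r 2, ← Real.rpow_mul hr, ← Real.rpow_natCast r 5]
    norm_num
  have h2 : (w ^ 2) ^ (-(5 / 2) : ℝ) = (w ^ 5)⁻¹ := by
    rw [Real.rpow_neg (by positivity), ← Real.rpow_natCast w 2, ← Real.rpow_mul hw,
      ← Real.rpow_natCast w 5]
    norm_num
  rw [h1, h2, Real.sqrt_sq hr]
  have hq : 1 ≤ r / w := (one_le_div hw0).2 hwr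
  have hX : r ^ 5 * (w ^ 5)⁻¹ = (r / w) ^ 5 := by rw [div_pow, div_eq_mul_inv]
  have h3 : 1 ≤ (r / w) ^ 5 := one_le_pow₀ hq
  have h4 : (r / w) ^ 4 ≤ (r / w) ^ 5 := pow_le_pow_right₀ hq (by norm_num)
  have h5 : (r / w) ^ 5 * (r ^ 2 / w ^ 3) ≤ (r / w) ^ 5 :=
    mul_le_of_le_one_right (by positivity) (div_le_one_of_le₀ hrw (by positivity))
  have h6 : 16 * (r ^ 2) ^ 2 * (12 * (w ^ 2) ^ 2 + 12 * (r ^ 2 * r)) / (w ^ 2) ^ 4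
      = 192 * (r / w) ^ 4 + 192 * ((r / w) ^ 5 * (r ^ 2 / w ^ 3)) := by
    field_simp
    ring
  rw [h6, hX]
  linarith

/-- The elementary inequality behind the two logarithmic ranges. -/
theorem missing_le_log {x n L : ℝ} (hn : 1 ≤ n) (hnx : n ≤ x) (hL : 1 ≤ L) :
    1 + 16 * x ^ 2 * (2 ^ 36 * (n ^ 2 * L)) / n ^ 4
      ≤ 2 ^ 41 * (x ^ (2 : ℝ) * n ^ (-2 : ℝ) * L) := by
  have hn0 : 0 < n := by linarith
  have h1 : x ^ (2 : ℝ) * n ^ (-2 : ℝ) = (x / n) ^ 2 := by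
    rw [Real.rpow_neg hn0.le, Real.rpow_two, Real.rpow_two, div_pow, div_eq_mul_inv]
  have h2 : 16 * x ^ 2 * (2 ^ 36 * (n ^ 2 * L)) / n ^ 4 = 2 ^ 40 * ((x / n) ^ 2 * L) := by
    field_simp
    ring
  have h3 : 1 ≤ (x / n) ^ 2 := one_le_pow₀ ((one_le_div hn0).2 hnx)
  have h4 : 1 ≤ (x / n) ^ 2 * L := one_le_mul_of_one_le_of_one_le h3 hL
  rw [h1, h2]
  linarith

theorem sq_mul_log_le_medium {x n L : ℝ} (hx : 0 < x) (hn : 0 < n)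
    (h : x ^ (1 / 2 : ℝ) * L ≤ n) :
    x ^ (2 : ℝ) * n ^ (-2 : ℝ) * L ≤ x ^ (3 / 2 : ℝ) * n ^ (-1 : ℝ) := by
  have h1 : x ^ (2 : ℝ) * n ^ (-2 : ℝ) * L
      = x ^ (3 / 2 : ℝ) * n ^ (-2 : ℝ) * (x ^ (1 / 2 : ℝ) * L) := by
    rw [show (2 : ℝ) = 3 / 2 + 1 / 2 by norm_num, Real.rpow_add hx]
    norm_num
    ring
  have h2 : n ^ (-1 : ℝ) = n ^ (-2 : ℝ) * n := by
    rw [show (-1 : ℝ) = -2 + 1 by norm_num, Real.rpow_add hn, Real.rpow_one]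
  rw [h1, h2, ← mul_assoc (x ^ (3 / 2 : ℝ))]
  exact mul_le_mul_of_nonneg_left h (by positivity)

theorem sq_le_of_le_rpow_half {x n : ℝ} (hx : 0 ≤ x) (hn : 0 ≤ n) (h : n ≤ x ^ (1 / 2 : ℝ)) :
    n ^ 2 ≤ x := by
  rw [← Real.sqrt_eq_rpow] at h
  exact (Real.le_sqrt hn hx).1 h

theorem le_sq_of_rpow_half_le {x n : ℝ} (hx : 0 ≤ x) (h : x ^ (1 / 2 : ℝ) ≤ n) : x ≤ n ^ 2 := by
  rw [← Real.sqrt_eq_rpow] at h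
  calc x = √x ^ 2 := (Real.sq_sqrt hx).symm
    _ ≤ n ^ 2 := pow_le_pow_left₀ (Real.sqrt_nonneg _) h 2

/-- The quantitative claims for a set at least as large as the support of one of the two counting
functions. -/
theorem bounds_of_isShiftCount {H : Finset (ZMod p)} (hH : IsMulSubgroup H) {l m : ZMod p}
    (hl : l ≠ 0) (hm : m ≠ 0) {c : ZMod p → ℕ} (hc : IsShiftCount H l m c) {N : ℕ}
    (hN : supportCard c ≤ N) :
    (1 < H.card → (H.card : ℝ) ≤ ((p : ℝ) * Real.log p) ^ (1 / 2 : ℝ) →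
      1 / 2 ^ 42 * ((H.card : ℝ) ^ 2 / Real.log H.card) ≤ (N : ℝ)) ∧
    ((p : ℝ) ^ (2 / 3 : ℝ) ≤ (H.card : ℝ) →
      (p : ℝ) - N ≤ 2 ^ 41 * ((p : ℝ) ^ (5 / 2 : ℝ) * (H.card : ℝ) ^ (-(5 / 2) : ℝ))) ∧
    ((H.card : ℝ) < (p : ℝ) ^ (2 / 3 : ℝ) →
      (p : ℝ) ^ (1 / 2 : ℝ) * Real.log p ≤ (H.card : ℝ) →
      (p : ℝ) - N ≤ 2 ^ 41 * ((p : ℝ) ^ (3 / 2 : ℝ) * (H.card : ℝ) ^ (-1 : ℝ))) ∧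
    ((H.card : ℝ) ≤ (p : ℝ) ^ (1 / 2 : ℝ) * Real.log p →
      ((p : ℝ) * Real.log p) ^ (1 / 2 : ℝ) < (H.card : ℝ) →
      (p : ℝ) - N ≤
        2 ^ 41 * ((p : ℝ) ^ (2 : ℝ) * (H.card : ℝ) ^ (-2 : ℝ) * Real.log p)) := by
  have hp2 : (2 : ℝ) ≤ p := by exact_mod_cast (Fact.out : p.Prime).two_le
  have hnp : (H.card : ℝ) ≤ p := by exact_mod_cast hH.card_lt.le
  have hn1 : (1 : ℝ) ≤ H.card := by exact_mod_cast hH.card_pos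
  have hN' : (supportCard c : ℝ) ≤ N := by exact_mod_cast hN
  have hlog0 : 0 ≤ Real.log p := Real.log_nonneg (by linarith)
  refine ⟨fun hn h => ?_, fun h => ?_, ?_⟩
  · refine (hc.le_supportCard hH hl hm hn ?_).trans hN'
    exact sq_le_of_le_rpow_half (by positivity) (by positivity) h
  · have h3 := sq_le_pow_three_of_rpow_le (by linarith) h
    have hn : 2 ≤ H.card := by
      by_contra hcon
      have h1 : H.card = 1 := by have := hH.card_pos; omega
      rw [h1] at h3
      have := (Fact.out : p.Prime).two_le
      norm_num at h3
      omega
    have h4 := hc.sub_supportCard_le hn (variance_le_of_sqrt hH hl hm)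
    have h5 := missing_le_large hn1 hnp h3
    have h6 : (0 : ℝ) ≤ (p : ℝ) ^ (5 / 2 : ℝ) * (H.card : ℝ) ^ (-(5 / 2) : ℝ) := by positivity
    linarith
  rcases Nat.lt_or_ge 1 H.card with hn | hn
  · have hL := one_le_log_of_two_le_card hH hn
    have key : (p : ℝ) ≤ (H.card : ℝ) ^ 2 →
        (H.card ^ 3 ≤ p ^ 2 ∨ (H.card : ℝ) ^ 2 ≤ p * Real.log p ^ 2) →
        (p : ℝ) - N ≤ 2 ^ 41 * ((p : ℝ) ^ (2 : ℝ) * (H.card : ℝ) ^ (-2 : ℝ) * Real.log p) := by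
      intro h1 h2
      have h4 := hc.sub_supportCard_le hn (variance_le_log hH hl hm hn h1 h2)
      have h5 := missing_le_log hn1 hnp hL
      linarith
    refine ⟨fun h1 h2 => ?_, fun h1 h2 => ?_⟩
    · have h3 : H.card ^ 3 ≤ p ^ 2 := by
        exact_mod_cast pow_three_le_sq_of_le_rpow (by linarith) (by linarith) h1.le
      have h4 : (p : ℝ) ≤ (H.card : ℝ) ^ 2 := by
        refine le_sq_of_rpow_half_le (by linarith) (le_trans ?_ h2)
        exact le_mul_of_one_le_right (by positivity) hL
      refine (key h4 (Or.inl h3)).trans ?_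
      have := sq_mul_log_le_medium (by linarith) (by linarith) h2
      linarith
    · have h4 := le_sq_of_rpow_half_le (by positivity) h2.le
      refine key (by nlinarith) (Or.inr ?_)
      have h5 := pow_le_pow_left₀ (by positivity) h1 2
      rw [mul_pow, ← Real.sqrt_eq_rpow, Real.sq_sqrt (by linarith)] at h5
      exact h5
  -- the trivial group: the right-hand sides exceed `p`
  · have h1 : H.card = 1 := by have := hH.card_pos; omega
    have hN0 : (0 : ℝ) ≤ N := Nat.cast_nonneg _
    rw [h1]
    simp only [Nat.cast_one, Real.one_rpow, mul_one]
    refine ⟨fun _ _ => ?_, fun _ _ => ?_⟩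
    · have h2 : (p : ℝ) ^ (1 : ℝ) ≤ (p : ℝ) ^ (3 / 2 : ℝ) :=
        Real.rpow_le_rpow_of_exponent_le (by linarith) (by norm_num)
      rw [Real.rpow_one] at h2
      linarith
    · rw [Real.rpow_two]
      have h2 := Real.log_le_log (by norm_num) hp2
      have h3 := Real.log_two_gt_d9
      have h4 : (p : ℝ) ≤ p ^ 2 * (2 * Real.log p) := by nlinarith
      nlinarith

end Assembly



theorem corollary4p2 :
    ∃ c C : ℝ, 0 < c ∧ 0 < C ∧
      ∀ (p : ℕ) [Fact p.Prime] (G : Subgroup (ZMod p)ˣ) (l m : ZMod p), l ≠ 0 → m ≠ 0 →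
        -- large subgroups: everything nonzero is represented
        ((p : ℝ) ^ (2 / 3 : ℝ) ≤ (Nat.card G : ℝ) →
          {x : ZMod p | x ≠ 0} ⊆ tripleSumset G l m ∧
          {x : ZMod p | x ≠ 0} ⊆ subgroupSet G * shiftedRatioSet G l m) ∧
        -- the remaining claims hold for both sets
        (∀ S : Set (ZMod p), S = tripleSumset G l m ∨ S = shiftedRatioSet G l m →
          (1 < Nat.card G → (Nat.card G : ℝ) ≤ ((p : ℝ) * Real.log p) ^ (1 / 2 : ℝ) →
            c * ((Nat.card G : ℝ) ^ 2 / Real.log (Nat.card G)) ≤ (S.ncard : ℝ)) ∧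
          ((p : ℝ) ^ (2 / 3 : ℝ) ≤ (Nat.card G : ℝ) →
            (p : ℝ) - S.ncard ≤
              C * ((p : ℝ) ^ (5 / 2 : ℝ) * (Nat.card G : ℝ) ^ (-(5 / 2) : ℝ))) ∧
          ((Nat.card G : ℝ) < (p : ℝ) ^ (2 / 3 : ℝ) →
            (p : ℝ) ^ (1 / 2 : ℝ) * Real.log p ≤ (Nat.card G : ℝ) →
            (p : ℝ) - S.ncard ≤
              C * ((p : ℝ) ^ (3 / 2 : ℝ) * (Nat.card G : ℝ) ^ (-1 : ℝ))) ∧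
          ((Nat.card G : ℝ) ≤ (p : ℝ) ^ (1 / 2 : ℝ) * Real.log p →
            ((p : ℝ) * Real.log p) ^ (1 / 2 : ℝ) < (Nat.card G : ℝ) →
            (p : ℝ) - S.ncard ≤
              C * ((p : ℝ) ^ (2 : ℝ) * (Nat.card G : ℝ) ^ (-2 : ℝ) * Real.log p))) := by
  refine ⟨1 / 2 ^ 42, 2 ^ 41, by norm_num, by norm_num, fun p _ G l m hl hm => ?_⟩
  have hH := isMulSubgroup_subgroupFinset G
  rw [← card_subgroupFinset G]
  refine ⟨fun h => ?_, ?_⟩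
  · have h3 : p ^ 2 ≤ (subgroupFinset G).card ^ 3 := by
      exact_mod_cast sq_le_pow_three_of_rpow_le (Nat.cast_nonneg p) h
    refine ⟨fun x hx => ?_, fun x hx => ?_⟩
    · obtain ⟨u, hu, v, hv, w, hw, rfl⟩ := exists_triple_of_large hH h3 hl hm hx
      exact mem_tripleSumset hu hv hw
    · obtain ⟨g, hg, u, hu, v, hv, hvm, rfl⟩ := exists_ratio_of_large hH h3 hl hm hx
      exact Set.mul_mem_mul (mem_subgroupFinset.1 hg)
        ⟨u, mem_subgroupFinset.1 hu, v, mem_subgroupFinset.1 hv, hvm, rfl⟩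
  · rintro S (rfl | rfl)
    · exact bounds_of_isShiftCount hH (neg_ne_zero.2 hm) (neg_ne_zero.2 hl) (Or.inr rfl)
        (supportCard_prodCount_le_ncard G l m)
    · exact bounds_of_isShiftCount hH hl hm (Or.inl rfl) (supportCard_ratioCount_le_ncard G l m)
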